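/- Setting. Let $n\ge 1$, $0\le k\le n$, $M\ge 1$ be integers. Let $\mathsf{Cl}_2$ be the single-qubit Clifford group (unitaries conjugating Pauli matrices into the Pauli group, modulo global phase). For $z\in\{0,1\}^n$ put $P_z=\bigotimes_i Z^{z_i}$ and $\Pi_z=\bigotimes_i\Pi_{z_i}$, where $\Pi_0(A)=\tfrac12\mathrm{tr}(A)I$ and $\Pi_1=\mathrm{id}-\Pi_0$ on single-qubit operators. One round of the experiment on an $n$-qubit state $\sigma$ with noise channel $\Lambda$ means: draw $U=U_1\otimes\cdots\otimes U_n$ uniformly from $\mathsf{Cl}_2^{\otimes n}$ and observe $b\in\{0,1\}^n$ with probability $\langle b|\Lambda(U\sigma U^\dagger)|b\rangle$. The median of means of $NK$ numbers is the median of the $K$ means of consecutive batches of $N$ of them. The protocol RShadow with $\mathsf{Cl}_2^{\otimes n}$ and parameters $N_C,K_C,N_E,K_E\in\mathbb N_+$: (calibration) perform $N_CK_C$ rounds on $|0\rangle\langle 0|^{\otimes n}$ and, for each $z$, let $\hat f_z$ be the median of means (with parameters $N_C,K_C$) of the numbers $\langle b|UP_zU^\dagger|b\rangle$; put $\widehat{\mathcal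 M}^{-1}=\sum_z\hat f_z^{-1}\Pi_z$. (estimation) perform $N_EK_E$ rounds on the unknown state $\rho$ and, for each given observable $O_i$, output the median of means $\hat o_i$ (with parameters $N_E,K_E$) of the numbers $\mathrm{tr}\big(O_i\,\widehat{\mathcal M}^{-1}(U^\dagger|b\rangle\langle b|U)\big)$. All rounds are independent, with the same noise $\Lambda$. For a single-qubit channel $\Lambda_i$ let $F_Z(\Lambda_i)=\frac12\sum_{b\in\{0,1\}}\langle b|\Lambda_i(|b\rangle\langle b|)|b\rangle$. An observable is $k$-local if it has the form $\tilde O_S\otimes I_{[n]\setminus S}$ with $|S|=k$. Theorem. Let $0\le\xi<\frac12$, $\varepsilon_1,\varepsilon_2>0$ and $\delta_1,\delta_2\in(0,1)$. Say that parameters $(N_C,K_C,N_E,K_E)$ are good if for every local noise $\Lambda=\bigotimes_{i=1}^n\Lambda_i$ with quantum channels $\Lambda_i$ satisfying $F_Z(\Lambda_i)\ge1-\xi$ for all $i$, every $n$-qubit state $\rho$, and all $k$-local observables $O_1,\dots,O_M$ with $\|O_i\|_\infty\le1$, the protocol satisfies $$\Pr\big(|\hat o_i-\mathrm{Tr}(O_i\rho)|\le\varepsilon_1+\varepsilon_2\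 \text{ for all } i=1,\dots,M\big)\ \ge\ 1-\delta_1-\delta_2 .$$ Put $$R_C=68\cdot3^k\Big(1+\frac{2^k}{\varepsilon_1}\Big)^2\big(k\ln n+\ln(2\delta_1^{-1})\big)(1-2\xi)^{-2k},\qquad R_E=\frac{34}{\varepsilon_2^2}\,4^k\ln(2M/\delta_2)\,(1+\varepsilon_1)^2(1-2\xi)^{-2k}.$$ (1) The parameters are good whenever $N_C\ge 34\cdot3^k(1+\frac{2^k}{\varepsilon_1})^2(1-2\xi)^{-2k}$, $K_C\ge2(k\ln n+\ln(2\delta_1^{-1}))$, $N_E\ge\frac{34}{\varepsilon_2^2}4^k(1+\varepsilon_1)^2(1-2\xi)^{-2k}$ and $K_E\ge\ln(2M/\delta_2)$; the products of these lower bounds are $R_C$ and $R_E$. (2) If moreover $\varepsilon_2\le1$, then $R_C$ calibration and $R_E$ estimation samples suffice: for all integers $R_1\ge R_C$ and $R_2\ge R_E$ there are good positive integers $N_C,K_C,N_E,K_E$ with $N_CK_C\le R_1$ and $N_EK_E\le R_2$. -/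

import Mathlib

open MeasureTheory
open scoped ComplexOrder

noncomputable section

namespace RShadow

/-- Computational basis labels of `n` qubits: bit strings of length `n`. -/
abbrev Bits (n : ℕ) : Type := Fin n → Fin 2

/-- Operators on one qubit. -/
abbrev QubitOp : Type := Matrix (Fin 2) (Fin 2) ℂ

/-- Operators on `n` qubits, written in the computational basis. -/
abbrev Op (n : ℕ) : Type := Matrix (Bits n) (Bits n) ℂ

/-- The projector `|b⟩⟨b|` onto a computational basis state. -/
def basisState {ι : Type} [DecidableEq ι] (b : ι) : Matrix ι ι ℂ := Matrix.single b b 1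

/-- A density operator. -/
def IsState {ι : Type} [Fintype ι] (ρ : Matrix ι ι ℂ) : Prop :=
  ρ.PosSemidef ∧ ρ.trace = 1

/-! ### Channels -/

/-- The map `id_m ⊗ E`, applied blockwise. -/
def ampliation {ι : Type} (E : Matrix ι ι ℂ →ₗ[ℂ] Matrix ι ι ℂ) (m : ℕ)
    (A : Matrix (Fin m × ι) (Fin m × ι) ℂ) : Matrix (Fin m × ι) (Fin m × ι) ℂ :=
  Matrix.of fun p q => E (Matrix.of fun x y => A (p.1, x) (q.1, y)) p.2 q.2

/-- A quantum channel: a completely positive and trace preserving linear map. -/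
structure IsChannel {ι : Type} [Fintype ι] (E : Matrix ι ι ℂ →ₗ[ℂ] Matrix ι ι ℂ) : Prop where
  completelyPositive : ∀ (m : ℕ) (A : Matrix (Fin m × ι) (Fin m × ι) ℂ),
    A.PosSemidef → (ampliation E m A).PosSemidef
  tracePreserving : ∀ A : Matrix ι ι ℂ, (E A).trace = A.trace

/-- The `Z`-basis average fidelity `F_Z(E)`, the average over `b` of `⟨b| E(|b⟩⟨b|) |b⟩`. -/
def zFidelity {ι : Type} [Fintype ι] [DecidableEq ι]
    (E : Matrix ι ι ℂ →ₗ[ℂ] Matrix ι ι ℂ) : ℝ :=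
  (∑ b, (E (basisState b) b b).re) / Fintype.card ι

/-- The tensor product `A₁ ⊗ ⋯ ⊗ Aₙ` of one-qubit operators. -/
def tensorOp {n : ℕ} (A : Fin n → QubitOp) : Op n :=
  Matrix.of fun x y => ∏ i, A i (x i) (y i)

/-- The tensor product `E₁ ⊗ ⋯ ⊗ Eₙ` of one-qubit superoperators: the linear map which sends
the matrix unit `|u⟩⟨v|` to the tensor product of the `Eᵢ(|uᵢ⟩⟨vᵢ|)`. -/
def tensorMap {n : ℕ} (E : Fin n → QubitOp →ₗ[ℂ] QubitOp) : Op n →ₗ[ℂ] Op n where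
  toFun A := ∑ u, ∑ v, A u v • tensorOp fun i => E i (Matrix.single (u i) (v i) 1)
  map_add' A B := by
    simp only [Matrix.add_apply, add_smul, Finset.sum_add_distrib]
  map_smul' c A := by
    simp only [Matrix.smul_apply, smul_eq_mul, mul_smul, Finset.smul_sum, RingHom.id_apply]

/-! ### The local Clifford group -/

/-- The one-qubit Pauli matrices `I, X, Y, Z`. -/
def pauli : Fin 4 → QubitOp :=
  ![1, !![0, 1; 1, 0], !![0, -Complex.I; Complex.I, 0], !![1, 0; 0, -1]]

/-- The underlying set `{iʲ P}` of the one-qubit Pauli group. -/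
def pauliGroup : Set QubitOp :=
  {A | ∃ (j : Fin 4) (a : Fin 4), A = Complex.I ^ (j : ℕ) • pauli a}

/-- The one-qubit unitaries that conjugate Pauli matrices into the Pauli group. -/
def CliffordUnitary : Type :=
  {g : Matrix.unitaryGroup (Fin 2) ℂ //
    ∀ a, (g : QubitOp) * pauli a * star (g : QubitOp) ∈ pauliGroup}

/-- The matrix of a Clifford unitary. -/
def CliffordUnitary.mat (g : CliffordUnitary) : QubitOp := (g.1 : QubitOp)

/-- Equality up to a global phase. -/
def phaseSetoid : Setoid CliffordUnitary where
  r g h := ∃ c : ℂ, ‖c‖ = 1 ∧ g.mat = c • h.mat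
  iseqv :=
    { refl := fun g => ⟨1, by simp, by simp⟩
      symm := by
        rintro g h ⟨c, hc, e⟩
        have hc0 : c ≠ 0 := by
          rintro rfl
          simp at hc
        exact ⟨c⁻¹, by simp [hc], by rw [e, smul_smul, inv_mul_cancel₀ hc0, one_smul]⟩
      trans := by
        rintro g h l ⟨c, hc, e⟩ ⟨d, hd, e'⟩
        exact ⟨c * d, by simp [hc, hd], by rw [e, e', smul_smul]⟩ }

/-- The one-qubit Clifford group (a finite set of 24 elements): Clifford unitaries up to phase. -/
def Cl2 : Type := Quotient phaseSetoid

/-- A unitary representing an element of the one-qubit Clifford group. All quantities below are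
quadratic of the form `U A U†`, so that the choice of phase does not matter. -/
def Cl2.mat (g : Cl2) : QubitOp := (Quotient.out (s := phaseSetoid) g).mat

/-- The unitary `U = U₁ ⊗ ⋯ ⊗ Uₙ` of an element of the local Clifford group. -/
def localUnitary {n : ℕ} (U : Fin n → Cl2) : Op n := tensorOp fun i => (U i).mat

/-! ### One round of the experiment -/

/-- The record of one round: the sampled local Clifford element and the measured bit string. -/
structure Round (n : ℕ) : Type where
  U : Fin n → Cl2
  b : Bits n

instance (n : ℕ) : MeasurableSpace (Round n) := ⊤

/-- The law of one round on the input state `ρ` with noise `Λ`: the element `U` is uniform on the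
local Clifford group, and given `U` the outcome `b` has probability `⟨b| Λ(U ρ U†) |b⟩`. -/
def roundLaw {n : ℕ} (Λ : Op n →ₗ[ℂ] Op n) (ρ : Op n) : Measure (Round n) :=
  Measure.sum fun r : Round n =>
    ENNReal.ofReal ((Nat.card (Fin n → Cl2) : ℝ)⁻¹ *
      (Λ (localUnitary r.U * ρ * star (localUnitary r.U)) r.b r.b).re) • Measure.dirac r

/-- The joint law of `N * K` independent rounds, arranged in `K` batches of `N` rounds. -/
def roundsLaw {n : ℕ} (Λ : Op n →ₗ[ℂ] Op n) (ρ : Op n) (N K : ℕ) :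
    Measure (Fin K × Fin N → Round n) :=
  Measure.pi fun _ => roundLaw Λ ρ

/-! ### Median of means -/

/-- The median of `K` real numbers (mean of the two middle values if `K` is even). -/
def median {K : ℕ} (x : Fin K → ℝ) : ℝ :=
  if h : 0 < K then
    (x (Tuple.sort x ⟨(K - 1) / 2, by omega⟩) + x (Tuple.sort x ⟨K / 2, by omega⟩)) / 2
  else 0

/-- The median of the `K` batch means. -/
def medianOfMeans {N K : ℕ} (x : Fin K × Fin N → ℝ) : ℝ :=
  median fun t => (∑ j, x (t, j)) / N

/-! ### Calibration -/

/-- The Pauli operator `P_z`, the tensor product of the `Z ^ zᵢ`. -/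
def pauliZ {n : ℕ} (z : Bits n) : Op n :=
  tensorOp fun i => if z i = 0 then pauli 0 else pauli 3

/-- The single-round estimator `⟨b| U P_z U† |b⟩` of the Pauli fidelity `f_z`. -/
def noiseEst {n : ℕ} (z : Bits n) (r : Round n) : ℝ :=
  ((basisState r.b * (localUnitary r.U * pauliZ z * star (localUnitary r.U))).trace).re

/-- The median of means estimator of the Pauli fidelity `f_z`. -/
def fHat {n N K : ℕ} (cal : Fin K × Fin N → Round n) (z : Bits n) : ℝ :=
  medianOfMeans fun r => noiseEst z (cal r)

/-- The one-qubit projector `A ↦ (tr A / 2) I` onto multiples of the identity. -/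
def identityProj : QubitOp →ₗ[ℂ] QubitOp :=
  ((2 : ℂ)⁻¹ • Matrix.traceLinearMap (Fin 2) ℂ ℂ).smulRight (1 : QubitOp)

/-- The superoperator `Π_z`, the tensor product of `identityProj` (where `zᵢ = 0`) and its
complementary projector (where `zᵢ = 1`). -/
def sectorProj {n : ℕ} (z : Bits n) : Op n →ₗ[ℂ] Op n :=
  tensorMap fun i => if z i = 0 then identityProj else LinearMap.id - identityProj

/-- The superoperator `∑_z f_z⁻¹ Π_z`. -/
def inverseChannel {n : ℕ} (f : Bits n → ℝ) : Op n →ₗ[ℂ] Op n :=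
  ∑ z, ((f z : ℂ))⁻¹ • sectorProj z

/-! ### Estimation -/

/-- The single-round estimator `tr(O† M⁻¹(U† |b⟩⟨b| U))`, with `M⁻¹ = ∑_z f_z⁻¹ Π_z`. -/
def singleEstimate {n : ℕ} (f : Bits n → ℝ) (O : Op n) (r : Round n) : ℝ :=
  ((star O * inverseChannel f
    (star (localUnitary r.U) * basisState r.b * localUnitary r.U)).trace).re

/-- The output of the robust shadow estimation protocol for the observable `O`, from the
calibration record `cal` and the estimation record `est`. -/
def estimate {n N₁ K₁ N₂ K₂ : ℕ} (cal : Fin K₁ × Fin N₁ → Round n)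
    (est : Fin K₂ × Fin N₂ → Round n) (O : Op n) : ℝ :=
  medianOfMeans fun r => singleEstimate (fHat cal) O (est r)

/-- The joint law of the calibration record (`N₁ * K₁` rounds on `|0⟩⟨0|`) and the estimation
record (`N₂ * K₂` rounds on `ρ`), all rounds independent and with the same noise `Λ`. -/
def protocolLaw {n : ℕ} (Λ : Op n →ₗ[ℂ] Op n) (ρ : Op n) (N₁ K₁ N₂ K₂ : ℕ) :
    Measure ((Fin K₁ × Fin N₁ → Round n) × (Fin K₂ × Fin N₂ → Round n)) :=
  (roundsLaw Λ (basisState 0) N₁ K₁).prod (roundsLaw Λ ρ N₂ K₂)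

/-- `O` is `k`-local: `O = Õ_S ⊗ I` for a set `S` of exactly `k` qubits. -/
def IsLocal {n : ℕ} (k : ℕ) (O : Op n) : Prop :=
  ∃ S : Finset (Fin n), S.card = k ∧
    ∃ A : Matrix (S → Fin 2) (S → Fin 2) ℂ,
      ∀ x y, O x y = A (fun i => x i) (fun i => y i) * if ∀ i ∉ S, x i = y i then 1 else 0

/-- The protocol with calibration parameters `N₁, K₁` and estimation parameters `N₂, K₂` estimates
any `M` `k`-local observables of operator norm at most one, in any `n`-qubit state and under any
local noise with `F_Z(Λᵢ) ≥ 1 - ξ`, simultaneously to accuracy `ε` with probability at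
least `p`. -/
def Succeeds (n k M : ℕ) (ξ ε p : ℝ) (N₁ K₁ N₂ K₂ : ℕ) : Prop :=
  ∀ Λ : Fin n → QubitOp →ₗ[ℂ] QubitOp,
    (∀ i, IsChannel (Λ i)) → (∀ i, 1 - ξ ≤ zFidelity (Λ i)) →
  ∀ ρ : Op n, IsState ρ →
  ∀ O : Fin M → Op n,
    (∀ i, (O i).IsHermitian) → (∀ i, IsLocal k (O i)) →
    (∀ i, ‖Matrix.toEuclideanCLM (𝕜 := ℂ) (O i)‖ ≤ 1) →
  p ≤ (protocolLaw (tensorMap Λ) ρ N₁ K₁ N₂ K₂).real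
    {ω | ∀ i, |estimate ω.1 ω.2 (O i) - ((O i * ρ).trace).re| ≤ ε}

end RShadow

end

noncomputable section

namespace RShadow

/-! ### Pauli matrices -/

/-! In the Pauli basis the protocol is diagonal. A local Clifford element sends a Pauli string P_a
to a signed Pauli string, so its value ⟨b|U P_a U†|b⟩ in a round (`roundVal`) lies in {-1, 0, 1}.
Write z for the support pattern of a. The mean of this value is f_z tr(P_a ρ), where f_z is the
product of (2 F_Z(Λ_i) - 1)/3 over the support, and its second moment is 3^{-|z|}, whatever the
noise. Both moments factorise over qubits (`sum_roundProb_mul_prod`), which leaves the one-qubit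
averages `sum_channel_mul_diagVal` and `sum_channel_mul_diagVal_sq`.

Calibration. With t = 1 - 2ξ and |z| ≤ k one has f_z ≥ 3^{-|z|} t^k. Median of means gives f_z up to
the relative error γ = ε₁/(ε₁ + 2^k), which means that f_z / f̂_z is within ε₁/2^k of 1. At most
(n+1)^k patterns have to be controlled (`calibration_tail`).

Estimation. Let c_a be the Pauli coefficients of a k-local O. At most 4^k of them are nonzero and
their squares sum to at most 1, so their absolute values sum to at most 2^k and the bias is at most
ε₁ (`abs_integral_singleEstimate_sub_le`). In each round the strings supported in S with nonzero
value have total weight ∑ 3^{|a|} = 4^k; Cauchy-Schwarz with these weights bounds the second moment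
by (1+ε₁)² t^{-2k} 4^k (`integral_singleEstimate_sq_le`).

Median of means. If one batch fails with probability at most s² (Chebyshev), the median fails with
probability at most (2s)^K, by a union over the sets of failing batches (`medianOfMeans_tail`).
Taking s = 1/(2e) yields e^{-K} and needs the constant 4e² < 34. The slack between 4e² and 34 also
pays for rounding a total budget to an integer number of batches (`exists_batches`). -/

lemma pauli_mul_self (a : Fin 4) : pauli a * pauli a = 1 := by
  fin_cases a <;> ext i j <;> fin_cases i <;> fin_cases j <;>
    simp [pauli, Matrix.mul_apply, Fin.sum_univ_two]

lemma star_pauli (a : Fin 4) : star (pauli a) = pauli a := by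
  fin_cases a <;> ext i j <;> fin_cases i <;> fin_cases j <;> simp [pauli, Matrix.star_apply]

lemma trace_pauli {a : Fin 4} (ha : a ≠ 0) : (pauli a).trace = 0 := by
  fin_cases a <;> simp_all [pauli, Matrix.trace, Fin.sum_univ_two]

lemma pauli_zero : pauli 0 = 1 := rfl

/-- Completeness of the Pauli matrices. -/
lemma sum_pauli_mul_pauli (x y u v : Fin 2) :
    ∑ a, pauli a x y * pauli a u v = if x = v ∧ y = u then 2 else 0 := by
  fin_cases x <;> fin_cases y <;> fin_cases u <;> fin_cases v <;>
    simp [pauli, Fin.sum_univ_four] <;> norm_num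

lemma trace_mul_eq_sum {ι : Type} [Fintype ι] (A B : Matrix ι ι ℂ) :
    (A * B).trace = ∑ x, ∑ y, A x y * B y x := by
  simp [Matrix.trace, Matrix.mul_apply]

/-- Expansion of a one-qubit operator in Pauli matrices. -/
lemma pauli_expansion (A : QubitOp) :
    A = (2 : ℂ)⁻¹ • ∑ a, (A * pauli a).trace • pauli a := by
  ext x y
  have h : (∑ a, (A * pauli a).trace • pauli a) x y
      = ∑ u, ∑ v, A u v * ∑ a, pauli a v u * pauli a x y := by
    simp only [Matrix.sum_apply, Matrix.smul_apply, smul_eq_mul, trace_mul_eq_sum,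
      Finset.sum_mul, Finset.mul_sum, mul_assoc]
    rw [Finset.sum_comm]
    exact Finset.sum_congr rfl fun u _ => Finset.sum_comm
  rw [Matrix.smul_apply, h]
  simp only [sum_pauli_mul_pauli]
  fin_cases x <;> fin_cases y <;> simp [Fin.sum_univ_two] <;> ring

lemma linearMap_ext_pauli {V : Type*} [AddCommGroup V] [Module ℂ V] {F G : QubitOp →ₗ[ℂ] V}
    (h : ∀ a, F (pauli a) = G (pauli a)) : F = G := by
  ext1 A
  rw [pauli_expansion A]
  simp [h]

/-- Two distinct Pauli matrices are told apart by a Pauli matrix which commutes with the first and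
anticommutes with the second, if the second is not the identity. -/
lemma exists_pauli_commute_anticommute {a c : Fin 4} (ha : a ≠ 0) (hc : c ≠ a) :
    ∃ e, pauli e * pauli c * star (pauli e) = pauli c ∧
      pauli e * pauli a * star (pauli e) = -pauli a := by
  have key : ∀ e f : Fin 4, e ≠ 0 → f ≠ 0 → e ≠ f →
      pauli e * pauli f * star (pauli e) = -pauli f := by
    intro e f he hf hef
    rw [star_pauli]
    fin_cases e <;> fin_cases f <;> simp at he hf hef <;>
      ext i j <;> fin_cases i <;> fin_cases j <;>
      simp [pauli, Matrix.mul_apply, Fin.sum_univ_two]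
  by_cases hc0 : c = 0
  · obtain ⟨e, he, hea⟩ : ∃ e : Fin 4, e ≠ 0 ∧ e ≠ a := by
      clear hc
      revert a
      decide
    refine ⟨e, ?_, key e a he ha hea⟩
    rw [hc0, pauli_zero, mul_one, star_pauli, pauli_mul_self]
  · refine ⟨c, ?_, key c a hc0 ha hc⟩
    rw [star_pauli, pauli_mul_self, one_mul]

/-! ### The action of the Clifford group by conjugation -/

/-- Conjugation by an element of the one-qubit Clifford group. -/
def ad (g : Cl2) : QubitOp →ₗ[ℂ] QubitOp := LinearMap.mulLeftRight ℂ (g.mat, star g.mat)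

lemma ad_apply (g : Cl2) (A : QubitOp) : ad g A = g.mat * A * star g.mat := rfl

lemma Cl2.mat_mul_star (g : Cl2) : g.mat * star g.mat = 1 :=
  Matrix.mem_unitaryGroup_iff.1 (Quotient.out (s := phaseSetoid) g).1.2

lemma Cl2.star_mul_mat (g : Cl2) : star g.mat * g.mat = 1 :=
  Matrix.mem_unitaryGroup_iff'.1 (Quotient.out (s := phaseSetoid) g).1.2

lemma ad_pauli_mem (g : Cl2) (a : Fin 4) : ad g (pauli a) ∈ pauliGroup :=
  (Quotient.out (s := phaseSetoid) g).2 a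

lemma ad_one (g : Cl2) : ad g 1 = 1 := by
  rw [ad_apply, mul_one, g.mat_mul_star]

lemma ad_pauli_zero (g : Cl2) : ad g (pauli 0) = 1 := ad_one g

lemma ad_mul (g : Cl2) (A B : QubitOp) : ad g (A * B) = ad g A * ad g B := by
  have h : g.mat * A * star g.mat * (g.mat * B * star g.mat)
      = g.mat * A * (star g.mat * g.mat) * B * star g.mat := by noncomm_ring
  rw [ad_apply, ad_apply, ad_apply, h, g.star_mul_mat]
  noncomm_ring

lemma trace_ad (g : Cl2) (A : QubitOp) : (ad g A).trace = A.trace := by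
  rw [ad_apply, Matrix.trace_mul_comm, ← mul_assoc, g.star_mul_mat, one_mul]

/-- A Clifford element permutes the nontrivial Pauli matrices up to sign. -/
lemma ad_pauli (g : Cl2) {a : Fin 4} (ha : a ≠ 0) :
    ∃ c, c ≠ 0 ∧ (ad g (pauli a) = pauli c ∨ ad g (pauli a) = -pauli c) := by
  obtain ⟨j, c, h⟩ := ad_pauli_mem g a
  have hI : (Complex.I ^ (j : ℕ)) ≠ 0 := pow_ne_zero _ Complex.I_ne_zero
  refine ⟨c, ?_, ?_⟩
  · rintro rfl
    have ht := trace_ad g (pauli a)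
    rw [h, trace_pauli ha, Matrix.trace_smul, pauli_zero] at ht
    simp at ht
  · have hs : ad g (pauli a) * ad g (pauli a) = 1 := by
      rw [← ad_mul, pauli_mul_self, ad_one]
    rw [h, smul_mul_smul_comm, pauli_mul_self] at hs
    have h2 : Complex.I ^ (j : ℕ) * Complex.I ^ (j : ℕ) = 1 := by
      simpa using congrFun (congrFun hs 0) 0
    rcases mul_self_eq_one_iff.1 h2 with h1 | h1 <;> rw [h, h1] <;> simp

/-- The product `star h.mat * g.mat` commutes with X and Z, hence is a scalar, and unitarity makes
the scalar a phase. This gives finiteness of `Cl2`. -/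
lemma eq_of_ad_eq {g h : Cl2} (hgh : ∀ a, ad g (pauli a) = ad h (pauli a)) : g = h := by
  apply Quotient.out_equiv_out.1
  set w := star h.mat * g.mat with hw
  have hcomm : ∀ a, w * pauli a = pauli a * w := by
    intro a
    have h1 := hgh a
    rw [ad_apply, ad_apply] at h1
    calc w * pauli a = star h.mat * (g.mat * pauli a * (star g.mat * g.mat)) := by
          rw [g.star_mul_mat, hw]; noncomm_ring
      _ = star h.mat * (g.mat * pauli a * star g.mat) * g.mat := by noncomm_ring
      _ = star h.mat * h.mat * pauli a * star h.mat * g.mat := by rw [h1]; noncomm_ring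
      _ = pauli a * w := by rw [h.star_mul_mat, hw]; noncomm_ring
  have hZ := hcomm 3
  have hX := hcomm 1
  have h01 := congrFun (congrFun hZ 0) 1
  have h10 := congrFun (congrFun hZ 1) 0
  have h00 := congrFun (congrFun hX 0) 1
  simp [pauli, Matrix.mul_apply, Fin.sum_univ_two] at h01 h10 h00
  have e01 : w 0 1 = 0 := by linear_combination (-1 / 2 : ℂ) * h01
  have e10 : w 1 0 = 0 := by linear_combination (1 / 2 : ℂ) * h10
  have ew : w = w 0 0 • 1 := by
    ext i j
    fin_cases i <;> fin_cases j <;> simp [e01, e10, h00]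
  have hg : g.mat = w 0 0 • h.mat := by
    calc g.mat = h.mat * star h.mat * g.mat := by rw [h.mat_mul_star, one_mul]
      _ = h.mat * w := by rw [hw, mul_assoc]
      _ = w 0 0 • h.mat := by rw [ew]; simp
  have hww : w * star w = 1 := by
    rw [hw, star_mul, star_star, mul_assoc, ← mul_assoc g.mat, g.mat_mul_star, one_mul,
      h.star_mul_mat]
  refine ⟨w 0 0, ?_, hg⟩
  have h1 := congrFun (congrFun hww 0) 0
  simp only [Matrix.mul_apply, Fin.sum_univ_two, e01, zero_mul, add_zero, Matrix.star_apply,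
    Matrix.one_apply_eq] at h1
  have h2 : ((‖w 0 0‖ ^ 2 : ℝ) : ℂ) = 1 := by
    rw [← h1]; push_cast; exact (Complex.mul_conj' _).symm
  have h3 : ‖w 0 0‖ ^ 2 = 1 := by exact_mod_cast h2
  nlinarith [norm_nonneg (w 0 0)]

lemma finite_pauliGroup : pauliGroup.Finite := by
  have : pauliGroup = Set.range fun p : Fin 4 × Fin 4 => Complex.I ^ (p.1 : ℕ) • pauli p.2 := by
    ext A
    simp [pauliGroup, eq_comm]
  rw [this]
  exact Set.finite_range _

instance : Finite Cl2 := by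
  have := finite_pauliGroup.to_subtype
  refine Finite.of_injective (β := Fin 4 → pauliGroup)
    (fun g a => ⟨ad g (pauli a), ad_pauli_mem g a⟩) ?_
  intro g h hgh
  exact eq_of_ad_eq fun a => congrArg Subtype.val (congrFun hgh a)

instance : Fintype Cl2 := Fintype.ofFinite Cl2

/-- A unitary that conjugates Pauli matrices into the Pauli group, as a Clifford unitary. -/
def cliffordOf (c : QubitOp) (hc : c * star c = 1)
    (h : ∀ a, c * pauli a * star c ∈ pauliGroup) : CliffordUnitary :=
  ⟨⟨c, Matrix.mem_unitaryGroup_iff.2 hc⟩, h⟩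

lemma cliffordOf_mat (c : QubitOp) (hc : c * star c = 1)
    (h : ∀ a, c * pauli a * star c ∈ pauliGroup) : (cliffordOf c hc h).mat = c := rfl

/-- The class of a Clifford unitary up to phase. -/
def Cl2.mk (c : CliffordUnitary) : Cl2 := Quotient.mk phaseSetoid c

instance : Nonempty Cl2 :=
  ⟨Cl2.mk (cliffordOf 1 (by simp) fun a => ⟨0, a, by simp⟩)⟩

/-- The representative chosen in the quotient differs from `c` by a phase, which cancels against its
conjugate. -/
lemma ad_mk (c : CliffordUnitary) (A : QubitOp) :
    ad (Cl2.mk c) A = c.mat * A * star c.mat := by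
  obtain ⟨z, hz, h⟩ := Quotient.mk_out (s := phaseSetoid) c
  change (Cl2.mk c).mat = _ at h
  have hzz : z * star z = 1 := by
    have := Complex.mul_conj' z
    rw [hz] at this
    simpa using this
  rw [ad_apply, h, star_smul, smul_mul_assoc, smul_mul_assoc, mul_smul_comm, smul_smul, hzz,
    one_smul]

/-- Right multiplication of a Clifford element by a Clifford unitary. -/
def mulClifford (c : CliffordUnitary) (g : Cl2) : Cl2 :=
  Cl2.mk <| cliffordOf (g.mat * c.mat)
    (by
      have hc : c.mat * star c.mat = 1 := Matrix.mem_unitaryGroup_iff.1 c.1.2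
      rw [star_mul, mul_assoc, ← mul_assoc c.mat, hc, one_mul, g.mat_mul_star])
    (by
      intro a
      obtain ⟨j, b, h⟩ := c.2 a
      obtain ⟨j', b', h'⟩ := ad_pauli_mem g b
      change c.mat * pauli a * star c.mat = _ at h
      have e : g.mat * c.mat * pauli a * star (g.mat * c.mat)
          = ad g (c.mat * pauli a * star c.mat) := by
        rw [ad_apply, star_mul]; noncomm_ring
      rw [e, h, map_smul, h', smul_smul, ← pow_add]
      refine ⟨⟨((j : ℕ) + j') % 4, Nat.mod_lt _ (by norm_num)⟩, b', ?_⟩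
      rw [Complex.I_pow_eq_pow_mod])

lemma ad_mulClifford (c : CliffordUnitary) (g : Cl2) (A : QubitOp) :
    ad (mulClifford c g) A = ad g (c.mat * A * star c.mat) := by
  rw [mulClifford, ad_mk, cliffordOf_mat, ad_apply, star_mul]
  noncomm_ring

lemma mulClifford_bijective (c : CliffordUnitary) : Function.Bijective (mulClifford c) := by
  refine Finite.injective_iff_bijective.1 fun g h hgh => ?_
  refine eq_of_ad_eq fun a => ?_
  have hc : c.mat * star c.mat = 1 := Matrix.mem_unitaryGroup_iff.1 c.1.2
  have key : ∀ g : Cl2, ad g (pauli a) = ad (mulClifford c g) (star c.mat * pauli a * c.mat) := by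
    intro g
    rw [ad_mulClifford]
    congr 1
    calc pauli a = (c.mat * star c.mat) * pauli a * (c.mat * star c.mat) := by rw [hc]; simp
      _ = _ := by noncomm_ring
  rw [key g, key h, hgh]

/-- A quantity that depends on a Clifford element only through its action by conjugation has the
same average after right multiplication by a Clifford unitary. -/
lemma sum_ad_comp {V : Type*} [AddCommMonoid V] (F : (QubitOp → QubitOp) → V)
    (c : CliffordUnitary) :
    ∑ g, F (fun A => ad g (c.mat * A * star c.mat)) = ∑ g, F (fun A => ad g A) := by
  rw [← (mulClifford_bijective c).sum_comp fun g => F (fun A => ad g A)]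
  exact Finset.sum_congr rfl fun g _ => by simp only [ad_mulClifford]

/-- The Pauli matrices as Clifford unitaries. -/
def pauliClifford (e : Fin 4) : CliffordUnitary :=
  cliffordOf (pauli e) (by rw [star_pauli, pauli_mul_self]) (by
    intro a
    by_cases ha : a = 0
    · exact ⟨0, 0, by rw [ha, pauli_zero, mul_one, star_pauli, pauli_mul_self]; simp⟩
    by_cases hea : pauli e * pauli a * star (pauli e) = pauli a
    · exact ⟨0, a, by rw [hea]; simp⟩
    · refine ⟨2, a, ?_⟩
      have : e ≠ a := by
        rintro rfl
        exact hea (by rw [star_pauli, pauli_mul_self, one_mul])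
      rw [star_pauli] at hea ⊢
      fin_cases e <;> fin_cases a <;> simp [pauli_zero] at this ha hea <;>
        ext i j <;> fin_cases i <;> fin_cases j <;>
        simp [pauli, Matrix.mul_apply, Fin.sum_univ_two])

lemma pauliClifford_mat (e : Fin 4) : (pauliClifford e).mat = pauli e := rfl

/-- The rotation `(1 + i (X + Y + Z)) / 2`, which permutes the axes cyclically. -/
def cyclicMat : QubitOp :=
  (2 : ℂ)⁻¹ • !![1 + Complex.I, 1 + Complex.I; Complex.I - 1, 1 - Complex.I]

lemma cyclicMat_conj (a : Fin 4) :
    cyclicMat * pauli a * star cyclicMat = pauli (![0, 3, 1, 2] a) := by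
  fin_cases a <;> ext i j <;> fin_cases i <;> fin_cases j <;>
    simp [pauli, cyclicMat, Matrix.mul_apply, Fin.sum_univ_two, Matrix.star_apply] <;>
    ring_nf <;> simp [map_ofNat] <;> ring

/-- The cyclic rotation as a Clifford unitary. -/
def cyclicClifford : CliffordUnitary :=
  cliffordOf cyclicMat (by simpa [pauli_zero] using cyclicMat_conj 0)
    fun a => ⟨0, ![0, 3, 1, 2] a, by rw [cyclicMat_conj]; simp⟩

/-! ### One-qubit moments -/

/-- The diagonal entry `⟨b| g P_a g† |b⟩`. -/
def diagVal (g : Cl2) (a : Fin 4) (b : Fin 2) : ℝ := (ad g (pauli a) b b).re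

lemma ofReal_diagVal (g : Cl2) (a : Fin 4) (b : Fin 2) :
    (diagVal g a b : ℂ) = ad g (pauli a) b b := by
  by_cases ha : a = 0
  · simp [diagVal, ha, ad_pauli_zero]
  · obtain ⟨c, hc, h | h⟩ := ad_pauli g ha <;> rw [diagVal, h] <;> clear h <;>
      fin_cases c <;> fin_cases b <;> simp [pauli]

lemma diagVal_zero (g : Cl2) (b : Fin 2) : diagVal g 0 b = 1 := by
  simp [diagVal, ad_pauli_zero]

/-- The diagonals of ±X and ±Y vanish, and those of I and ±Z have entries of modulus one, so the
square does not see the outcome. This is why trace preservation alone determines the second moments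
under noise. -/
lemma diagVal_sq_eq (g : Cl2) (a : Fin 4) (b : Fin 2) : diagVal g a b ^ 2 = diagVal g a 0 ^ 2 := by
  by_cases ha : a = 0
  · simp [ha, diagVal_zero]
  · obtain ⟨c, hc, h | h⟩ := ad_pauli g ha <;> rw [diagVal, diagVal, h] <;> clear h <;>
      fin_cases c <;> fin_cases b <;> simp [pauli]

lemma abs_diagVal (g : Cl2) (a : Fin 4) (b : Fin 2) : |diagVal g a b| = diagVal g a b ^ 2 := by
  by_cases ha : a = 0
  · simp [ha, diagVal_zero]
  · obtain ⟨c, hc, h | h⟩ := ad_pauli g ha <;> rw [diagVal, h] <;> clear h <;>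
      fin_cases c <;> fin_cases b <;> simp [pauli]

/-- The pure state `g† |b⟩⟨b| g`. -/
def shadowState (g : Cl2) (b : Fin 2) : QubitOp := star g.mat * basisState b * g.mat

lemma trace_basisState_mul {ι : Type} [Fintype ι] [DecidableEq ι] (b : ι) (A : Matrix ι ι ℂ) :
    (basisState b * A).trace = A b b := by
  simp [basisState, Matrix.trace_single_mul]

lemma trace_shadowState_mul_pauli (g : Cl2) (a : Fin 4) (b : Fin 2) :
    (shadowState g b * pauli a).trace = diagVal g a b := by
  rw [ofReal_diagVal, ← trace_basisState_mul b (ad g (pauli a)), ad_apply, shadowState, mul_assoc,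
    mul_assoc, Matrix.trace_mul_comm]
  congr 1
  noncomm_ring

lemma shadowState_expansion (g : Cl2) (b : Fin 2) :
    shadowState g b = (2 : ℂ)⁻¹ • ∑ a, (diagVal g a b : ℂ) • pauli a := by
  conv_lhs => rw [pauli_expansion (shadowState g b)]
  simp only [trace_shadowState_mul_pauli]

/-- This is the purity of `shadowState g b` in Pauli coordinates. The identity contributes 1, so
exactly one nontrivial Pauli matrix has a nonzero value. -/
lemma sum_diagVal_sq (g : Cl2) (b : Fin 2) : ∑ a, diagVal g a b ^ 2 = 2 := by
  have h1 : (shadowState g b * shadowState g b).trace = 1 := by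
    have : shadowState g b * shadowState g b
        = star g.mat * basisState b * (g.mat * star g.mat) * basisState b * g.mat := by
      rw [shadowState]; noncomm_ring
    rw [this, g.mat_mul_star, mul_one, Matrix.trace_mul_comm]
    have h2 : g.mat * (star g.mat * basisState b * basisState b)
        = (g.mat * star g.mat) * (basisState b * basisState b) := by noncomm_ring
    rw [h2, g.mat_mul_star, one_mul, trace_basisState_mul]
    simp [basisState]
  have h2 : (shadowState g b * shadowState g b).trace
      = (2 : ℂ)⁻¹ * ∑ a, (diagVal g a b : ℂ) ^ 2 := by
    conv_lhs => enter [1, 2]; rw [shadowState_expansion]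
    simp [Matrix.mul_sum, Matrix.trace_sum, trace_shadowState_mul_pauli, sq]
  rw [h1] at h2
  have h3 : (∑ a, (diagVal g a b : ℂ) ^ 2) = 2 := by linear_combination (-2 : ℂ) * h2
  exact_mod_cast h3

/-- The probability that a uniform Clifford element maps `P_a` to `±Z` (or to `I` if `a = 0`). -/
def axisProb (a : Fin 4) : ℝ := if a = 0 then 1 else 3⁻¹

lemma sum_diagVal_cyclic (a : Fin 4) (b : Fin 2) :
    ∑ g, diagVal g (![0, 3, 1, 2] a) b ^ 2 = ∑ g, diagVal g a b ^ 2 := by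
  have h := sum_ad_comp (fun F => ((F (pauli a) b b).re) ^ 2) cyclicClifford
  simp only [show cyclicClifford.mat = cyclicMat from rfl, cyclicMat_conj] at h
  exact h

/-- The second moment of the diagonal entries over the Clifford group. -/
lemma sum_diagVal_sq_clifford (a : Fin 4) (b : Fin 2) :
    ∑ g, diagVal g a b ^ 2 = Fintype.card Cl2 * axisProb a := by
  -- The cyclic rotation makes the sums for X, Y and Z equal. They share what remains of the total 2
  -- per element after the identity has taken 1.
  have h1 := sum_diagVal_cyclic 1 b
  have h2 := sum_diagVal_cyclic 2 b
  have h3 : ∑ g, ∑ a, diagVal g a b ^ 2 = 2 * (Fintype.card Cl2 : ℝ) := by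
    simp [sum_diagVal_sq, mul_comm]
  rw [Finset.sum_comm, Fin.sum_univ_four] at h3
  have h0 : ∑ g : Cl2, diagVal g 0 b ^ 2 = Fintype.card Cl2 := by simp [diagVal_zero]
  simp at h1 h2
  fin_cases a
  · simpa [axisProb] using h0
  all_goals simp [axisProb]; linarith

lemma tracePreserving_apply {E : QubitOp →ₗ[ℂ] QubitOp} (hE : IsChannel E) (A : QubitOp) :
    E A 0 0 + E A 1 1 = A 0 0 + A 1 1 := by
  simpa [Matrix.trace, Fin.sum_univ_two] using hE.tracePreserving A

lemma IsChannel.posSemidef {ι : Type} [Fintype ι] {E : Matrix ι ι ℂ →ₗ[ℂ] Matrix ι ι ℂ}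
    (hE : IsChannel E) {A : Matrix ι ι ℂ} (hA : A.PosSemidef) : (E A).PosSemidef := by
  have h := hE.completelyPositive 1 (A.submatrix Prod.snd Prod.snd) (hA.submatrix _)
  have h2 := h.submatrix (fun x : ι => ((0 : Fin 1), x))
  have e : E A = (ampliation E 1 (A.submatrix Prod.snd Prod.snd)).submatrix
      (fun x : ι => ((0 : Fin 1), x)) (fun x : ι => ((0 : Fin 1), x)) := rfl
  rwa [e]

/-- The contraction factor `2 F_Z - 1` of `Z` under a channel. -/
def zContraction (E : QubitOp →ₗ[ℂ] QubitOp) : ℝ := 2 * zFidelity E - 1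

lemma basisState_posSemidef {ι : Type} [Fintype ι] [DecidableEq ι] (b : ι) :
    (basisState b : Matrix ι ι ℂ).PosSemidef := by
  have : (basisState b : Matrix ι ι ℂ) = Matrix.diagonal (Pi.single b 1) := by
    rw [basisState, Matrix.diagonal_single]
  rw [this]
  refine Matrix.PosSemidef.diagonal fun i => ?_
  by_cases h : i = b
  · subst h; simp
  · simp [h]

/-- With Z = |0⟩⟨0| - |1⟩⟨1|, trace preservation turns the two bit-flip probabilities into one minus
the survival probabilities. Positivity makes the entries real, as `zFidelity` only keeps real parts.
-/
lemma channel_Z {E : QubitOp →ₗ[ℂ] QubitOp} (hE : IsChannel E) :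
    E (pauli 3) 0 0 - E (pauli 3) 1 1 = 2 * zContraction E := by
  have hreal : ∀ b : Fin 2, ((E (basisState b) b b).re : ℂ) = E (basisState b) b b := by
    intro b
    have := (hE.posSemidef (basisState_posSemidef b)).isHermitian.apply b b
    exact (Complex.conj_eq_iff_real.1 this).elim fun r hr => by rw [hr]; simp
  have hZ : pauli 3 = basisState 0 - basisState 1 := by
    ext i j; fin_cases i <;> fin_cases j <;> simp [pauli, basisState]
  have h0 := tracePreserving_apply hE (basisState 0)
  have h1 := tracePreserving_apply hE (basisState 1)
  simp [basisState] at h0 h1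
  rw [hZ, map_sub, zContraction, zFidelity]
  simp only [Fin.sum_univ_two, Fintype.card_fin, Matrix.sub_apply]
  push_cast
  rw [hreal, hreal]
  simp only [basisState]
  linear_combination -h0 - h1

/-- The Pauli fidelity of `P_a` for one qubit with noise `E`. -/
def pauliFidelity (E : QubitOp →ₗ[ℂ] QubitOp) (a : Fin 4) : ℝ :=
  if a = 0 then 1 else zContraction E * 3⁻¹

/-- The first moment of the diagonal entries for a noisy round on one qubit. -/
lemma sum_channel_mul_diagVal {E : QubitOp →ₗ[ℂ] QubitOp} (hE : IsChannel E) (a : Fin 4)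
    (Q : QubitOp) :
    ∑ g, ∑ b, E (ad g Q) b b * diagVal g a b
      = Fintype.card Cl2 * (((pauliFidelity E a : ℂ) • pauli a) * Q).trace := by
  let F : QubitOp →ₗ[ℂ] ℂ :=
    ∑ g, ∑ b, (diagVal g a b : ℂ) • (Matrix.entryLinearMap ℂ ℂ b b ∘ₗ E ∘ₗ ad g)
  let G : QubitOp →ₗ[ℂ] ℂ := (Fintype.card Cl2 : ℂ) • (Matrix.traceLinearMap (Fin 2) ℂ ℂ ∘ₗ
    LinearMap.mulLeft ℂ ((pauliFidelity E a : ℂ) • pauli a))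
  have hF : ∀ Q, F Q = ∑ g, ∑ b, E (ad g Q) b b * diagVal g a b := by
    intro Q; simp [F, mul_comm]
  have hG : ∀ Q, G Q = Fintype.card Cl2 * (((pauliFidelity E a : ℂ) • pauli a) * Q).trace := by
    intro Q; simp [G]
  rw [← hF, ← hG]
  refine LinearMap.congr_fun (linearMap_ext_pauli fun c => ?_) Q
  rw [hF, hG]
  by_cases ha : a = 0
  · subst ha
    have : ∀ g : Cl2, ∑ b, E (ad g (pauli c)) b b * (diagVal g 0 b : ℂ) = (pauli c).trace := by
      intro g
      rw [← trace_ad g, ← hE.tracePreserving]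
      simp [diagVal_zero, Matrix.trace]
    simp [this, pauliFidelity, pauli_zero]
  by_cases hca : c = a
  · subst hca
    -- If g sends P_c to ±Z, the two signs cancel and `channel_Z` applies; if it sends P_c to ±X or
    -- ±Y, the diagonal values vanish.
    have : ∀ g : Cl2, ∑ b, E (ad g (pauli c)) b b * (diagVal g c b : ℂ)
        = (diagVal g c 0 ^ 2 : ℝ) * (2 * zContraction E) := by
      intro g
      rw [← channel_Z hE]
      push_cast
      simp only [ofReal_diagVal, Fin.sum_univ_two]
      obtain ⟨d, hd, h | h⟩ := ad_pauli g ha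
      · rw [h]
        fin_cases d <;> simp [pauli] at hd ⊢; ring
      · simp only [h, map_neg, Matrix.neg_apply]
        fin_cases d <;> simp [pauli] at hd ⊢; ring
    simp only [this]
    rw [← Finset.sum_mul, ← Complex.ofReal_sum, sum_diagVal_sq_clifford, smul_mul_assoc,
      pauli_mul_self]
    simp [pauliFidelity, ha, axisProb]
    ring
  · obtain ⟨e, he1, he2⟩ := exists_pauli_commute_anticommute ha hca
    have h := sum_ad_comp (fun F => ∑ b, E (F (pauli c)) b b * (F (pauli a) b b)) (pauliClifford e)
    simp only [pauliClifford_mat, he1, he2, map_neg, Matrix.neg_apply, mul_neg,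
      Finset.sum_neg_distrib, ← ofReal_diagVal] at h
    have h0 : ∑ g, ∑ b, E (ad g (pauli c)) b b * (diagVal g a b : ℂ) = 0 := by
      linear_combination (-1 / 2 : ℂ) * h
    have h1 : (pauli a * pauli c).trace = 0 := by
      have : (pauli a * pauli c).trace = -(pauli a * pauli c).trace := by
        have hee : star (pauli e) * pauli e = 1 := by rw [star_pauli, pauli_mul_self]
        calc (pauli a * pauli c).trace
            = (star (pauli e) * pauli e * (pauli a * pauli c)).trace := by rw [hee, one_mul]
          _ = (pauli e * (pauli a * pauli c) * star (pauli e)).trace := by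
              rw [mul_assoc, Matrix.trace_mul_comm]
          _ = (pauli e * pauli a * (star (pauli e) * pauli e) * pauli c * star (pauli e)).trace := by
              rw [hee]; congr 1; noncomm_ring
          _ = ((pauli e * pauli a * star (pauli e)) * (pauli e * pauli c * star (pauli e))).trace := by
              congr 1; noncomm_ring
          _ = -(pauli a * pauli c).trace := by rw [he1, he2, neg_mul, Matrix.trace_neg]
      linear_combination (1 / 2 : ℂ) * this
    rw [h0, smul_mul_assoc, Matrix.trace_smul, h1]
    simp

/-- The second moment of the diagonal entries for a noisy round on one qubit. -/
lemma sum_channel_mul_diagVal_sq {E : QubitOp →ₗ[ℂ] QubitOp} (hE : IsChannel E) (a : Fin 4)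
    (Q : QubitOp) :
    ∑ g, ∑ b, E (ad g Q) b b * (diagVal g a b ^ 2 : ℝ)
      = Fintype.card Cl2 * (((axisProb a : ℂ) • (1 : QubitOp)) * Q).trace := by
  have : ∀ g : Cl2, ∑ b, E (ad g Q) b b * ((diagVal g a b ^ 2 : ℝ) : ℂ)
      = (diagVal g a 0 ^ 2 : ℝ) * Q.trace := by
    intro g
    rw [← trace_ad g, ← hE.tracePreserving]
    simp only [diagVal_sq_eq g a, Matrix.trace, Matrix.diag_apply, Finset.mul_sum, mul_comm]
  simp only [this]
  rw [← Finset.sum_mul, ← Complex.ofReal_sum, sum_diagVal_sq_clifford]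
  simp [mul_assoc]

/-! ### Tensor products -/

lemma sum_sum_prod {ι R : Type*} {κ κ' : ι → Type*} [Fintype ι] [DecidableEq ι] [CommSemiring R]
    [∀ i, Fintype (κ i)] [∀ i, Fintype (κ' i)] (h : ∀ i, κ i → κ' i → R) :
    ∑ u : ∀ i, κ i, ∑ v : ∀ i, κ' i, ∏ i, h i (u i) (v i) = ∏ i, ∑ u, ∑ v, h i u v := by
  rw [Fintype.prod_sum]
  exact Finset.sum_congr rfl fun u _ => (Fintype.prod_sum _).symm

lemma sum_comm_pairs {α β γ δ V : Type*} [Fintype α] [Fintype β] [Fintype γ] [Fintype δ]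
    [AddCommMonoid V] (F : α → β → γ → δ → V) :
    ∑ a, ∑ b, ∑ c, ∑ d, F a b c d = ∑ c, ∑ d, ∑ a, ∑ b, F a b c d := by
  have h : ∀ a, ∑ b, ∑ c, ∑ d, F a b c d = ∑ c, ∑ d, ∑ b, F a b c d := fun a => by
    rw [Finset.sum_comm]
    exact Finset.sum_congr rfl fun c _ => Finset.sum_comm
  simp only [h]
  rw [Finset.sum_comm]
  exact Finset.sum_congr rfl fun c _ => Finset.sum_comm

lemma tensorOp_apply {n : ℕ} (A : Fin n → QubitOp) (x y : Bits n) :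
    tensorOp A x y = ∏ i, A i (x i) (y i) := rfl

lemma tensorOp_mul {n : ℕ} (A B : Fin n → QubitOp) :
    tensorOp A * tensorOp B = tensorOp fun i => A i * B i := by
  ext x y
  simp only [Matrix.mul_apply, tensorOp_apply, Fintype.prod_sum, Finset.prod_mul_distrib]

lemma star_tensorOp {n : ℕ} (A : Fin n → QubitOp) :
    star (tensorOp A) = tensorOp fun i => star (A i) := by
  ext x y
  simp [Matrix.star_apply, tensorOp_apply]

lemma tensorOp_single {n : ℕ} (u v : Bits n) :
    (tensorOp fun i => Matrix.single (u i) (v i) 1) = Matrix.single u v 1 := by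
  ext x y
  simp only [tensorOp_apply, Matrix.single_apply, Finset.prod_ite_zero, Finset.prod_const_one,
    Finset.mem_univ, true_imp_iff, funext_iff, forall_and]

lemma tensorOp_basisState {n : ℕ} (b : Bits n) :
    (tensorOp fun i => basisState (b i)) = basisState b :=
  tensorOp_single b b

lemma tensorOp_one {n : ℕ} : (tensorOp fun _ : Fin n => (1 : QubitOp)) = 1 := by
  ext x y
  simp only [tensorOp_apply, Matrix.one_apply, Finset.prod_ite_zero, Finset.prod_const_one,
    Finset.mem_univ, true_imp_iff, funext_iff]

lemma tensorOp_smul {n : ℕ} (c : Fin n → ℂ) (A : Fin n → QubitOp) :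
    (tensorOp fun i => c i • A i) = (∏ i, c i) • tensorOp A := by
  ext x y
  simp [tensorOp_apply, Finset.prod_mul_distrib]

lemma tensorMap_apply {n : ℕ} (E : Fin n → QubitOp →ₗ[ℂ] QubitOp) (A : Op n) :
    tensorMap E A = ∑ u, ∑ v, A u v • tensorOp fun i => E i (Matrix.single (u i) (v i) 1) := rfl

lemma tensorMap_tensorOp {n : ℕ} (E : Fin n → QubitOp →ₗ[ℂ] QubitOp) (A : Fin n → QubitOp) :
    tensorMap E (tensorOp A) = tensorOp fun i => E i (A i) := by
  ext x y
  simp only [tensorMap_apply, Matrix.sum_apply, Matrix.smul_apply, smul_eq_mul, tensorOp_apply,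
    ← Finset.prod_mul_distrib]
  rw [sum_sum_prod fun i u v => A i u v * E i (Matrix.single u v 1) (x i) (y i)]
  refine Finset.prod_congr rfl fun i _ => ?_
  conv_rhs => rw [Matrix.matrix_eq_sum_single (A i)]
  simp only [map_sum, Matrix.sum_apply]
  refine Finset.sum_congr rfl fun u _ => Finset.sum_congr rfl fun v _ => ?_
  have : Matrix.single u v (A i u v) = A i u v • Matrix.single u v (1 : ℂ) := by simp
  rw [this, map_smul, Matrix.smul_apply, smul_eq_mul]

lemma op_eq_sum_tensorOp {n : ℕ} (ρ : Op n) :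
    ρ = ∑ u, ∑ v, ρ u v • tensorOp fun i => Matrix.single (u i) (v i) (1 : ℂ) := by
  conv_lhs => rw [Matrix.matrix_eq_sum_single ρ]
  simp [tensorOp_single]

/-- Local conjugation of a product operator. -/
lemma localUnitary_conj_tensorOp {n : ℕ} (U : Fin n → Cl2) (A : Fin n → QubitOp) :
    localUnitary U * tensorOp A * star (localUnitary U) = tensorOp fun i => ad (U i) (A i) := by
  rw [localUnitary, star_tensorOp, tensorOp_mul, tensorOp_mul]
  rfl

/-! ### Positivity -/

open scoped MatrixOrder Matrix.Norms.L2Operator in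
lemma exists_eq_star_mul_self {ι : Type} [Fintype ι] [DecidableEq ι] {A : Matrix ι ι ℂ}
    (hA : A.PosSemidef) : ∃ C : Matrix ι ι ℂ, A = star C * C :=
  CStarAlgebra.nonneg_iff_eq_star_mul_self.1 hA.nonneg

lemma trace_mul_nonneg_of_posSemidef {ι : Type} [Fintype ι] [DecidableEq ι] {A B : Matrix ι ι ℂ}
    (hA : A.PosSemidef) (hB : B.PosSemidef) : 0 ≤ (A * B).trace := by
  obtain ⟨C, rfl⟩ := exists_eq_star_mul_self hB
  rw [← mul_assoc, Matrix.trace_mul_comm, ← mul_assoc]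
  exact (hA.mul_mul_conjTranspose_same C).trace_nonneg

lemma tensorOp_posSemidef {n : ℕ} {A : Fin n → QubitOp} (hA : ∀ i, (A i).PosSemidef) :
    (tensorOp A).PosSemidef := by
  choose C hC using fun i => exists_eq_star_mul_self (hA i)
  have : tensorOp A = star (tensorOp C) * tensorOp C := by
    rw [star_tensorOp, tensorOp_mul]
    exact congrArg tensorOp (funext hC)
  rw [this]
  exact Matrix.posSemidef_conjTranspose_mul_self _

/-- The effect `E†(|b⟩⟨b|)` (transposed) of a channel is positive. -/
lemma effect_posSemidef {E : QubitOp →ₗ[ℂ] QubitOp} (hE : IsChannel E) (b : Fin 2) :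
    (Matrix.of fun u v => E (Matrix.single u v 1) b b : QubitOp).PosSemidef := by
  -- This is the unnormalised maximally entangled vector; the channel applied to one half gives the
  -- Choi matrix, of which the effect is a principal submatrix.
  let w : Fin 2 × Fin 2 → ℂ := fun p => if p.1 = p.2 then 1 else 0
  have h := (hE.completelyPositive 2 _ (Matrix.posSemidef_vecMulVec_self_star w)).submatrix
    (fun u : Fin 2 => (u, b))
  convert h using 1
  ext u v
  simp only [Matrix.of_apply, Matrix.submatrix_apply, ampliation]
  refine congrArg (fun A : QubitOp => E A b b) ?_
  ext x y
  simp [Matrix.single_apply, Matrix.vecMulVec_apply, w, ← ite_and, and_comm]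

/-- The entry is the pairing of A with the tensor product of the one-qubit effects, which is
positive. Complete positivity of the tensor product channel itself is not needed. -/
lemma tensorMap_diag_nonneg {n : ℕ} {E : Fin n → QubitOp →ₗ[ℂ] QubitOp}
    (hE : ∀ i, IsChannel (E i)) {A : Op n} (hA : A.PosSemidef) (b : Bits n) :
    0 ≤ tensorMap E A b b := by
  have h := trace_mul_nonneg_of_posSemidef hA
    (tensorOp_posSemidef fun i => effect_posSemidef (hE i) (b i)).transpose
  rw [trace_mul_eq_sum] at h
  simpa [tensorMap_apply, Matrix.sum_apply, tensorOp_apply] using h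

/-! ### Moments of one round -/

/-- A round as a pair. -/
def roundEquiv (n : ℕ) : (Fin n → Cl2) × Bits n ≃ Round n where
  toFun p := ⟨p.1, p.2⟩
  invFun r := (r.U, r.b)
  left_inv _ := rfl
  right_inv _ := rfl

instance (n : ℕ) : Fintype (Round n) := Fintype.ofEquiv _ (roundEquiv n)

instance (n : ℕ) : DiscreteMeasurableSpace (Round n) := ⟨fun _ => trivial⟩

/-- The probability of a round. -/
def roundProb {n : ℕ} (Λ : Op n →ₗ[ℂ] Op n) (ρ : Op n) (r : Round n) : ℝ :=
  (Nat.card (Fin n → Cl2) : ℝ)⁻¹ *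
    (Λ (localUnitary r.U * ρ * star (localUnitary r.U)) r.b r.b).re

lemma sum_round {n : ℕ} {V : Type*} [AddCommMonoid V] (F : Round n → V) :
    ∑ r, F r = ∑ U, ∑ b, F ⟨U, b⟩ := by
  rw [← (roundEquiv n).sum_comp, Fintype.sum_prod_type]
  rfl

lemma roundProb_nonneg {n : ℕ} {Λ : Fin n → QubitOp →ₗ[ℂ] QubitOp} (hΛ : ∀ i, IsChannel (Λ i))
    {ρ : Op n} (hρ : IsState ρ) (r : Round n) : 0 ≤ roundProb (tensorMap Λ) ρ r := by
  have h := tensorMap_diag_nonneg hΛ (hρ.1.mul_mul_conjTranspose_same (localUnitary r.U)) r.b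
  exact mul_nonneg (by positivity) (Complex.nonneg_iff.1 h).1

/-- Moments of product functions of a round factorise over the qubits. -/
lemma sum_roundProb_mul_prod {n : ℕ} {Λ : Fin n → QubitOp →ₗ[ℂ] QubitOp}
    {H : Fin n → Cl2 → Fin 2 → ℝ} {T : Fin n → QubitOp}
    (hH : ∀ i Q, ∑ g, ∑ b, Λ i (ad g Q) b b * H i g b = Fintype.card Cl2 * (T i * Q).trace)
    (ρ : Op n) :
    ∑ r, roundProb (tensorMap Λ) ρ r * ∏ i, H i (r.U i) (r.b i) = ((tensorOp T * ρ).trace).re := by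
  have hc : (Fintype.card Cl2 : ℂ) ^ n ≠ 0 :=
    pow_ne_zero _ (Nat.cast_ne_zero.2 Fintype.card_ne_zero)
  have key : ∑ U : Fin n → Cl2, ∑ b : Bits n,
      tensorMap Λ (localUnitary U * ρ * star (localUnitary U)) b b *
        ((∏ i, H i (U i) (b i) : ℝ) : ℂ) = (Fintype.card Cl2 : ℂ) ^ n * (tensorOp T * ρ).trace := by
    have e1 : ∀ (U : Fin n → Cl2) (b : Bits n),
        tensorMap Λ (localUnitary U * ρ * star (localUnitary U)) b b *
          ((∏ i, H i (U i) (b i) : ℝ) : ℂ)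
        = ∑ u, ∑ v, ρ u v * ∏ i, (Λ i (ad (U i) (Matrix.single (u i) (v i) 1)) (b i) (b i) *
            H i (U i) (b i)) := by
      intro U b
      conv_lhs => rw [op_eq_sum_tensorOp ρ]
      simp only [Matrix.mul_sum, Finset.sum_mul, mul_smul_comm, smul_mul_assoc, map_sum, map_smul,
        localUnitary_conj_tensorOp, tensorMap_tensorOp, Matrix.sum_apply, Matrix.smul_apply,
        smul_eq_mul, tensorOp_apply, Finset.prod_mul_distrib,
        Complex.ofReal_prod]
      simp only [mul_assoc]
    simp only [e1]
    have e2 : ∀ u v : Bits n, ∑ U : Fin n → Cl2, ∑ b : Bits n,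
        ∏ i, (Λ i (ad (U i) (Matrix.single (u i) (v i) 1)) (b i) (b i) * (H i (U i) (b i) : ℂ))
        = (Fintype.card Cl2 : ℂ) ^ n * tensorOp T v u := by
      intro u v
      rw [sum_sum_prod fun i g b => Λ i (ad g (Matrix.single (u i) (v i) 1)) b b * (H i g b : ℂ)]
      simp only [hH, Finset.prod_mul_distrib, Finset.prod_const, Finset.card_univ,
        Fintype.card_fin, tensorOp_apply, Matrix.trace_mul_single]
      simp
    calc _ = ∑ u, ∑ v, ρ u v * ∑ U : Fin n → Cl2, ∑ b : Bits n,
        ∏ i, (Λ i (ad (U i) (Matrix.single (u i) (v i) 1)) (b i) (b i) * (H i (U i) (b i) : ℂ)) := by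
          simp only [Finset.mul_sum]
          exact sum_comm_pairs _
      _ = _ := by
          simp only [e2]
          rw [Matrix.trace_mul_comm, trace_mul_eq_sum]
          simp only [Finset.mul_sum]
          refine Finset.sum_congr rfl fun u _ => Finset.sum_congr rfl fun v _ => by ring
  have h2 : (tensorOp T * ρ).trace = ((Fintype.card Cl2 : ℂ) ^ n)⁻¹ * ∑ U : Fin n → Cl2,
      ∑ b : Bits n, tensorMap Λ (localUnitary U * ρ * star (localUnitary U)) b b *
        ((∏ i, H i (U i) (b i) : ℝ) : ℂ) := by
    rw [key, inv_mul_cancel_left₀ hc]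
  have hcard : ((Fintype.card Cl2 : ℂ) ^ n)⁻¹ = (((Nat.card (Fin n → Cl2) : ℝ)⁻¹ : ℝ) : ℂ) := by
    simp [Nat.card_eq_fintype_card]
  rw [h2, hcard, Complex.re_ofReal_mul, sum_round, Complex.re_sum, Finset.mul_sum]
  refine Finset.sum_congr rfl fun U _ => ?_
  rw [Complex.re_sum, Finset.mul_sum]
  refine Finset.sum_congr rfl fun b _ => ?_
  rw [Complex.re_mul_ofReal, roundProb, mul_assoc]

/-- The tensor product of Pauli matrices. -/
def pauliString {n : ℕ} (a : Fin n → Fin 4) : Op n := tensorOp fun i => pauli (a i)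

/-- The value `⟨b| U P_a U† |b⟩` of a Pauli string in a round. -/
def roundVal {n : ℕ} (a : Fin n → Fin 4) (r : Round n) : ℝ :=
  ∏ i, diagVal (r.U i) (a i) (r.b i)

lemma abs_roundVal {n : ℕ} (a : Fin n → Fin 4) (r : Round n) :
    |roundVal a r| = roundVal a r ^ 2 := by
  simp only [roundVal, Finset.abs_prod, abs_diagVal, Finset.prod_pow]

lemma roundLaw_eq {n : ℕ} (Λ : Op n →ₗ[ℂ] Op n) (ρ : Op n) :
    roundLaw Λ ρ = ∑ r, ENNReal.ofReal (roundProb Λ ρ r) • Measure.dirac r := by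
  rw [roundLaw, Measure.sum_fintype]
  rfl

section

variable {n : ℕ} {Λ : Fin n → QubitOp →ₗ[ℂ] QubitOp} {ρ : Op n}

lemma sum_roundProb_mul_roundVal (hΛ : ∀ i, IsChannel (Λ i)) (a : Fin n → Fin 4) :
    ∑ r, roundProb (tensorMap Λ) ρ r * roundVal a r
      = (∏ i, pauliFidelity (Λ i) (a i)) * ((pauliString a * ρ).trace).re := by
  have h := sum_roundProb_mul_prod (H := fun i g b => diagVal g (a i) b)
    (fun i Q => sum_channel_mul_diagVal (hΛ i) (a i) Q) ρ
  rw [tensorOp_smul, smul_mul_assoc, Matrix.trace_smul, smul_eq_mul, ← Complex.ofReal_prod,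
    Complex.re_ofReal_mul] at h
  exact h

lemma sum_roundProb (hΛ : ∀ i, IsChannel (Λ i)) (hρ : IsState ρ) :
    ∑ r, roundProb (tensorMap Λ) ρ r = 1 := by
  have h := sum_roundProb_mul_roundVal (ρ := ρ) hΛ (fun _ => 0)
  simpa [roundVal, diagVal_zero, pauliFidelity, pauliString, pauli_zero, tensorOp_one, hρ.2] using h

lemma sum_roundProb_mul_roundVal_sq (hΛ : ∀ i, IsChannel (Λ i)) (hρ : IsState ρ)
    (a : Fin n → Fin 4) :
    ∑ r, roundProb (tensorMap Λ) ρ r * roundVal a r ^ 2 = ∏ i, axisProb (a i) := by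
  have h := sum_roundProb_mul_prod (H := fun i g b => diagVal g (a i) b ^ 2)
    (fun i Q => sum_channel_mul_diagVal_sq (hΛ i) (a i) Q) ρ
  rw [tensorOp_smul, smul_mul_assoc, Matrix.trace_smul, smul_eq_mul, ← Complex.ofReal_prod,
    Complex.re_ofReal_mul, tensorOp_one, one_mul, hρ.2, Complex.one_re, mul_one] at h
  simpa only [roundVal, Finset.prod_pow] using h

lemma isProbabilityMeasure_roundLaw (hΛ : ∀ i, IsChannel (Λ i)) (hρ : IsState ρ) :
    IsProbabilityMeasure (roundLaw (tensorMap Λ) ρ) := by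
  refine ⟨?_⟩
  rw [roundLaw_eq]
  simp only [Measure.coe_finsetSum, Finset.sum_apply, Measure.smul_apply, measure_univ,
    smul_eq_mul, mul_one]
  rw [← ENNReal.ofReal_sum_of_nonneg fun r _ => roundProb_nonneg hΛ hρ r, sum_roundProb hΛ hρ,
    ENNReal.ofReal_one]

lemma integral_roundLaw (hΛ : ∀ i, IsChannel (Λ i)) (hρ : IsState ρ) (X : Round n → ℝ) :
    ∫ r, X r ∂(roundLaw (tensorMap Λ) ρ) = ∑ r, roundProb (tensorMap Λ) ρ r * X r := by
  rw [roundLaw_eq, integral_finsetSum_measure fun r _ =>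
    (Integrable.of_finite (μ := Measure.dirac r)).smul_measure ENNReal.ofReal_ne_top]
  refine Finset.sum_congr rfl fun r _ => ?_
  rw [integral_smul_measure, integral_dirac, smul_eq_mul,
    ENNReal.toReal_ofReal (roundProb_nonneg hΛ hρ r)]

end

/-! ### Median of means -/

/-- If the median is farther than `η` from `m`, then so are at least half of the numbers. -/
lemma card_le_of_median_far {K : ℕ} (hK : 0 < K) (x : Fin K → ℝ) {m η : ℝ}
    (h : η < |median x - m|) :
    K ≤ 2 * (Finset.univ.filter fun t => η < |x t - m|).card := by
  have hmono : Monotone (x ∘ Tuple.sort x) := Tuple.monotone_sort x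
  have hcard : ∀ s : Finset (Fin K), (∀ j ∈ s, η < |x (Tuple.sort x j) - m|) →
      s.card ≤ (Finset.univ.filter fun t => η < |x t - m|).card := by
    intro s hs
    refine Finset.card_le_card_of_injOn (Tuple.sort x) (fun j hj => ?_)
      (Tuple.sort x).injective.injOn
    simpa using hs j hj
  have hle : x (Tuple.sort x ⟨(K - 1) / 2, by omega⟩) ≤ x (Tuple.sort x ⟨K / 2, by omega⟩) :=
    hmono (Fin.mk_le_mk.2 (by omega))
  rw [median, dif_pos hK] at h
  -- A median too large puts the sorted positions from K/2 upwards at fault, a median too small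
  -- those up to (K-1)/2; for either parity these are at least half of the positions.
  rcases lt_abs.1 h with h | h
  · have h1 := hcard (Finset.Ici ⟨K / 2, by omega⟩) fun j hj => by
      have : x (Tuple.sort x ⟨K / 2, by omega⟩) ≤ x (Tuple.sort x j) :=
        hmono (Finset.mem_Ici.1 hj)
      exact lt_abs.2 (Or.inl (by linarith))
    rw [Fin.card_Ici] at h1
    simp only at h1
    omega
  · have h1 := hcard (Finset.Iic ⟨(K - 1) / 2, by omega⟩) fun j hj => by
      have : x (Tuple.sort x j) ≤ x (Tuple.sort x ⟨(K - 1) / 2, by omega⟩) :=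
        hmono (Finset.mem_Iic.1 hj)
      exact lt_abs.2 (Or.inr (by linarith))
    rw [Fin.card_Iic] at h1
    simp only at h1
    omega

section

variable {Ω : Type} [MeasurableSpace Ω] [Finite Ω] [DiscreteMeasurableSpace Ω]
  (μ : Measure Ω) [IsProbabilityMeasure μ]

/-- Chebyshev's inequality for the mean of one batch. -/
lemma batchMean_tail (X : Ω → ℝ) {N : ℕ} (hN : 0 < N) {V η p : ℝ} (hη : 0 < η)
    (hV : ∫ ω, X ω ^ 2 ∂μ ≤ V) (h : V ≤ p * (N * η ^ 2)) :
    (Measure.pi fun _ : Fin N => μ).real {ω | η < |(∑ j, X (ω j)) / N - ∫ ω, X ω ∂μ|} ≤ p := by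
  have hN' : (0 : ℝ) < N := Nat.cast_pos.2 hN
  have hX : MemLp X 2 μ := MemLp.of_discrete
  set P := Measure.pi fun _ : Fin N => μ
  set Y : (Fin N → Ω) → ℝ := ∑ j, fun ω => X (ω j) with hY
  have hYv : ProbabilityTheory.variance Y P ≤ N * V := by
    rw [hY, ProbabilityTheory.variance_sum_pi fun _ => hX]
    simp only [Finset.sum_const, Finset.card_univ, Fintype.card_fin, nsmul_eq_mul]
    refine mul_le_mul_of_nonneg_left (le_trans ?_ hV) hN'.le
    exact ProbabilityTheory.variance_le_expectation_sq hX.aestronglyMeasurable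
  have hYm : ∫ ω, Y ω ∂P = N * ∫ ω, X ω ∂μ := by
    simp only [hY, Finset.sum_apply]
    rw [integral_finsetSum _ fun _ _ => Integrable.of_finite]
    have : ∀ j : Fin N, ∫ ω, X (ω j) ∂P = ∫ ω, X ω ∂μ := fun j => by
      rw [← (measurePreserving_eval (fun _ : Fin N => μ) j).map_eq,
        integral_map Measurable.of_discrete.aemeasurable AEStronglyMeasurable.of_discrete]
    simp [this]
  have hch := ProbabilityTheory.meas_ge_le_variance_div_sq (μ := P) (X := Y) MemLp.of_discrete
    (c := N * η) (by positivity)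
  rw [hYm] at hch
  have hsub : {ω : Fin N → Ω | η < |(∑ j, X (ω j)) / N - ∫ ω, X ω ∂μ|}
      ⊆ {ω | N * η ≤ |Y ω - N * ∫ ω, X ω ∂μ|} := by
    intro ω hω
    have hω' : η < |(∑ j, X (ω j)) / N - ∫ ω, X ω ∂μ| := hω
    have e : Y ω - N * ∫ ω, X ω ∂μ = N * ((∑ j, X (ω j)) / N - ∫ ω, X ω ∂μ) := by
      rw [mul_sub, mul_div_cancel₀ _ hN'.ne', hY, Finset.sum_apply]
    change N * η ≤ |Y ω - N * ∫ ω, X ω ∂μ|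
    rw [e, abs_mul, abs_of_pos hN']
    exact mul_le_mul_of_nonneg_left hω'.le hN'.le
  have hp : 0 ≤ V := le_trans (integral_nonneg fun _ => sq_nonneg _) hV
  have h0 : ProbabilityTheory.variance Y P / (N * η) ^ 2 ≤ p := by
    rw [div_le_iff₀ (by positivity)]
    nlinarith [mul_le_mul_of_nonneg_left h hN'.le]
  refine ENNReal.toReal_le_of_le_ofReal ?_ ((measure_mono hsub).trans (hch.trans
    (ENNReal.ofReal_le_ofReal h0)))
  exact le_trans (div_nonneg (ProbabilityTheory.variance_nonneg _ _) (sq_nonneg _)) h0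

/-- Regrouping the rounds by batch makes the batches themselves independent and identically
distributed. -/
lemma pi_prod_eq_map (K N : ℕ) :
    (Measure.pi fun _ : Fin K × Fin N => μ) =
      (Measure.pi fun _ : Fin K => Measure.pi fun _ : Fin N => μ).map
        (fun ω p => ω p.1 p.2) := by
  refine Measure.pi_eq fun s hs => ?_
  rw [Measure.map_apply Measurable.of_discrete (MeasurableSet.univ_pi hs)]
  have : (fun (ω : Fin K → Fin N → Ω) (p : Fin K × Fin N) => ω p.1 p.2) ⁻¹' Set.univ.pi s
      = Set.univ.pi fun t => Set.univ.pi fun j => s (t, j) := by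
    ext ω
    simp [Set.mem_pi]
  rw [this, Measure.pi_pi, Fintype.prod_prod_type]
  simp only [Measure.pi_pi]

/-- Deviation bound for the median of means. -/
lemma medianOfMeans_tail (X : Ω → ℝ) {N K : ℕ} (hN : 0 < N) (hK : 0 < K) {V η s : ℝ}
    (hη : 0 < η) (hs : 0 ≤ s) (hV : ∫ ω, X ω ^ 2 ∂μ ≤ V) (h : V ≤ s ^ 2 * (N * η ^ 2)) :
    (Measure.pi fun _ : Fin K × Fin N => μ).real
      {ω | η < |medianOfMeans (fun p => X (ω p)) - ∫ ω, X ω ∂μ|} ≤ (2 * s) ^ K := by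
  by_cases hs1 : 1 ≤ 2 * s
  · exact measureReal_le_one.trans (one_le_pow₀ hs1)
  have hs1 : s ≤ 1 := by linarith
  set m := ∫ ω, X ω ∂μ
  set Q := Measure.pi fun _ : Fin N => μ
  set B : Set (Fin N → Ω) := {ω | η < |(∑ j, X (ω j)) / N - m|}
  have hB : Q.real B ≤ s ^ 2 := batchMean_tail μ X hN hη hV h
  rw [pi_prod_eq_map, map_measureReal_apply Measurable.of_discrete MeasurableSet.of_discrete]
  -- Union over the possible sets T of failing batches with 2|T| ≥ K: each costs at most (s²)^|T| ≤
  -- s^K, and there are at most 2^K of them.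
  let F : Finset (Finset (Fin K)) := Finset.univ.filter fun T => K ≤ 2 * T.card
  have hsub : (fun (ω : Fin K → Fin N → Ω) (p : Fin K × Fin N) => ω p.1 p.2) ⁻¹'
      {ω | η < |medianOfMeans (fun p => X (ω p)) - m|}
      ⊆ ⋃ T ∈ F, Set.univ.pi fun t => if t ∈ T then B else Set.univ := by
    intro ω hω
    have h1 := card_le_of_median_far hK _ hω
    refine Set.mem_biUnion (x := Finset.univ.filter fun t => ω t ∈ B) ?_ ?_
    · simpa [F, B] using h1
    · intro t _
      by_cases ht : ω t ∈ B <;> simp [ht]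
  have hT : ∀ T ∈ F, (Measure.pi fun _ : Fin K => Q).real
      (Set.univ.pi fun t => if t ∈ T then B else Set.univ) ≤ s ^ K := by
    intro T hT
    rw [Measure.real, Measure.pi_pi, ENNReal.toReal_prod]
    have : ∀ t, (Q (if t ∈ T then B else Set.univ)).toReal = if t ∈ T then Q.real B else 1 := by
      intro t
      split_ifs <;> simp [Measure.real]
    simp only [this]
    rw [Finset.prod_ite_mem, Finset.univ_inter, Finset.prod_const]
    calc Q.real B ^ T.card ≤ (s ^ 2) ^ T.card := pow_le_pow_left₀ measureReal_nonneg hB _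
      _ = s ^ (2 * T.card) := by rw [pow_mul]
      _ ≤ s ^ K := pow_le_pow_of_le_one hs hs1 (by simpa [F] using hT)
  calc _ ≤ (Measure.pi fun _ : Fin K => Q).real
        (⋃ T ∈ F, Set.univ.pi fun t => if t ∈ T then B else Set.univ) :=
        measureReal_mono hsub (measure_ne_top _ _)
    _ ≤ ∑ T ∈ F, (Measure.pi fun _ : Fin K => Q).real
        (Set.univ.pi fun t => if t ∈ T then B else Set.univ) := measureReal_biUnion_finset_le _ _
    _ ≤ ∑ T ∈ F, s ^ K := Finset.sum_le_sum hT
    _ ≤ ∑ T : Finset (Fin K), s ^ K :=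
        Finset.sum_le_sum_of_subset_of_nonneg (Finset.subset_univ _) fun _ _ _ => pow_nonneg hs _
    _ = (2 * s) ^ K := by simp [mul_pow]

end

/-! ### Pauli strings -/

section

variable {n : ℕ}

lemma star_pauliString (a : Fin n → Fin 4) : star (pauliString a) = pauliString a := by
  simp only [pauliString, star_tensorOp, star_pauli]

lemma pauliString_mul_self (a : Fin n → Fin 4) : pauliString a * pauliString a = 1 := by
  simp only [pauliString, tensorOp_mul, pauli_mul_self, tensorOp_one]

lemma tensorOp_sum_smul_pauli (c : Fin n → Fin 4 → ℂ) :
    (tensorOp fun i => ∑ a, c i a • pauli a) = ∑ a, (∏ i, c i (a i)) • pauliString a := by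
  ext x y
  simp only [tensorOp_apply, Matrix.sum_apply, Matrix.smul_apply, smul_eq_mul, Fintype.prod_sum,
    pauliString, Finset.prod_mul_distrib]

/-- Completeness of the Pauli strings. -/
lemma sum_pauliString_mul (x y u v : Bits n) :
    ∑ a : Fin n → Fin 4, pauliString a x y * pauliString a u v
      = if x = v ∧ y = u then 2 ^ n else 0 := by
  simp only [pauliString, tensorOp_apply, ← Finset.prod_mul_distrib]
  rw [← Fintype.prod_sum fun i a => pauli a (x i) (y i) * pauli a (u i) (v i)]
  simp only [sum_pauli_mul_pauli, Finset.prod_ite_zero, Finset.mem_univ, true_imp_iff, funext_iff,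
    forall_and, Finset.prod_const, Finset.card_univ, Fintype.card_fin]

/-- The Parseval identity for Pauli strings. -/
lemma sum_trace_pauliString (A B : Op n) :
    ∑ a, (A * pauliString a).trace * (pauliString a * B).trace = 2 ^ n * (A * B).trace := by
  have h : ∀ a : Fin n → Fin 4, (A * pauliString a).trace * (pauliString a * B).trace
      = ∑ p : Bits n × Bits n, ∑ q : Bits n × Bits n,
        (A p.1 p.2 * pauliString a p.2 p.1) * (pauliString a q.1 q.2 * B q.2 q.1) := by
    intro a
    rw [trace_mul_eq_sum, trace_mul_eq_sum, ← Fintype.sum_prod_type', ← Fintype.sum_prod_type',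
      Finset.sum_mul_sum]
  rw [trace_mul_eq_sum, ← Fintype.sum_prod_type', Finset.mul_sum]
  simp only [h]
  calc _ = ∑ p : Bits n × Bits n, ∑ q : Bits n × Bits n, A p.1 p.2 * B q.2 q.1 *
        ∑ a, pauliString a p.2 p.1 * pauliString a q.1 q.2 := by
        rw [Finset.sum_comm]
        refine Finset.sum_congr rfl fun p _ => ?_
        rw [Finset.sum_comm]
        refine Finset.sum_congr rfl fun q _ => ?_
        rw [Finset.mul_sum]
        exact Finset.sum_congr rfl fun a _ => by ring
    _ = _ := by
        simp only [sum_pauliString_mul]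
        refine Finset.sum_congr rfl fun p _ => ?_
        rw [Fintype.sum_prod_type]
        simp [ite_and]
        ring

lemma ofReal_re_trace_mul {A B : Op n} (hA : star A = A) (hB : star B = B) :
    (((A * B).trace.re : ℝ) : ℂ) = (A * B).trace := by
  refine Complex.conj_eq_iff_re.1 ?_
  have : star ((A * B).trace) = (star (A * B)).trace := (Matrix.trace_conjTranspose _).symm
  rw [star_mul, hA, hB, Matrix.trace_mul_comm B A] at this
  exact this

/-- Since P_a² = 1, the operators 1 ± P_a satisfy (1 ± P_a)² = 2(1 ± P_a) and are therefore
positive; pairing them with ρ gives both bounds. -/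
lemma abs_re_trace_pauliString_mul_le {ρ : Op n} (hρ : IsState ρ) (a : Fin n → Fin 4) :
    |(pauliString a * ρ).trace.re| ≤ 1 := by
  have key : ∀ c : ℂ, star c = c → c * c = 1 → 0 ≤ 1 + (c * (pauliString a * ρ).trace).re := by
    intro c hc hcc
    have h := (hρ.1.mul_mul_conjTranspose_same (1 + c • pauliString a)).trace_nonneg
    have hstar : (1 + c • pauliString a).conjTranspose = 1 + c • pauliString a := by
      rw [← Matrix.star_eq_conjTranspose, star_add, star_smul, hc, star_one, star_pauliString]
    rw [hstar, Matrix.trace_mul_comm, ← mul_assoc] at h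
    have e : (1 + c • pauliString a) * (1 + c • pauliString a)
        = (2 : ℂ) • (1 + c • pauliString a) := by
      have h2 : (c • pauliString a) * (c • pauliString a) = 1 := by
        rw [smul_mul_smul_comm, hcc, pauliString_mul_self, one_smul]
      rw [add_mul, mul_add, mul_add, h2, one_mul, one_mul, mul_one, two_smul]
      abel
    rw [e, smul_mul_assoc, Matrix.trace_smul, add_mul, one_mul, Matrix.trace_add, hρ.2,
      smul_mul_assoc, Matrix.trace_smul] at h
    have h3 := (Complex.nonneg_iff.1 h).1
    simp at h3
    simpa using h3
  have h1 := key 1 (by simp) (by simp)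
  have h2 := key (-1) (by simp) (by simp)
  simp at h1 h2
  exact abs_le.2 ⟨by linarith, by linarith⟩

/-- The Pauli coefficient `2⁻ⁿ tr(O P_a)`. -/
def pauliCoeff (O : Op n) (a : Fin n → Fin 4) : ℝ := (2 ^ n)⁻¹ * (O * pauliString a).trace.re

lemma sum_pauliCoeff_mul {O B : Op n} (hO : star O = O) (hB : star B = B) :
    ∑ a, pauliCoeff O a * (pauliString a * B).trace.re = (O * B).trace.re := by
  have h := sum_trace_pauliString O B
  have e : ∑ a, (O * pauliString a).trace.re * (pauliString a * B).trace.re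
      = 2 ^ n * (O * B).trace.re := by
    have : (((∑ a, (O * pauliString a).trace.re * (pauliString a * B).trace.re : ℝ)) : ℂ)
        = ((2 ^ n * (O * B).trace.re : ℝ) : ℂ) := by
      push_cast
      simp only [ofReal_re_trace_mul hO (star_pauliString _),
        ofReal_re_trace_mul (star_pauliString _) hB, h, ofReal_re_trace_mul hO hB]
    exact_mod_cast this
  simp only [pauliCoeff, mul_assoc, ← Finset.mul_sum, e]
  rw [inv_mul_cancel_left₀ (by positivity)]

/-- The trace is the sum of the squared norms of the 2^n columns, each the image of a unit vector
under a contraction. -/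
lemma re_trace_sq_le {O : Op n} (hO : star O = O)
    (hn : ‖Matrix.toEuclideanCLM (𝕜 := ℂ) O‖ ≤ 1) : (O * O).trace.re ≤ 2 ^ n := by
  have hcol : ∀ x, ∑ y, ‖O y x‖ ^ 2 ≤ 1 := by
    intro x
    have h1 := (Matrix.toEuclideanCLM (𝕜 := ℂ) O).le_opNorm (EuclideanSpace.single x 1)
    have h2 : ‖Matrix.toEuclideanCLM (𝕜 := ℂ) O (EuclideanSpace.single x 1)‖ ≤ 1 := by
      refine h1.trans ?_
      simpa using hn
    have h3 : ‖Matrix.toEuclideanCLM (𝕜 := ℂ) O (EuclideanSpace.single x 1)‖ ^ 2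
        = ∑ y, ‖O y x‖ ^ 2 := by
      rw [EuclideanSpace.norm_sq_eq]
      simp
    rw [← h3]
    exact pow_le_one₀ (norm_nonneg _) h2
  have e : (O * O).trace.re = ∑ x, ∑ y, ‖O y x‖ ^ 2 := by
    conv_lhs => enter [1, 1, 1]; rw [← hO]
    rw [trace_mul_eq_sum, Complex.re_sum]
    refine Finset.sum_congr rfl fun x _ => ?_
    rw [Complex.re_sum]
    refine Finset.sum_congr rfl fun y _ => ?_
    rw [Matrix.star_apply, ← Complex.normSq_eq_norm_sq]
    simp [Complex.normSq_apply]
  rw [e]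
  calc _ ≤ ∑ x : Bits n, (1 : ℝ) := Finset.sum_le_sum fun x _ => hcol x
    _ = 2 ^ n := by simp

lemma sum_pauliCoeff_sq_le {O : Op n} (hO : star O = O)
    (hn : ‖Matrix.toEuclideanCLM (𝕜 := ℂ) O‖ ≤ 1) : ∑ a, pauliCoeff O a ^ 2 ≤ 1 := by
  have h := sum_pauliCoeff_mul hO hO
  have e : ∑ a, pauliCoeff O a ^ 2 = (2 ^ n)⁻¹ * (O * O).trace.re := by
    rw [← h, Finset.mul_sum]
    refine Finset.sum_congr rfl fun a _ => ?_
    rw [Matrix.trace_mul_comm, sq]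
    nth_rw 2 [pauliCoeff]
    ring
  rw [e, inv_mul_le_iff₀ (by positivity), mul_one]
  exact re_trace_sq_le hO hn

/-- The Pauli strings supported in `S`. -/
def stringsIn (S : Finset (Fin n)) : Finset (Fin n → Fin 4) :=
  Fintype.piFinset fun i => if i ∈ S then Finset.univ else {0}

lemma mem_stringsIn {S : Finset (Fin n)} {a : Fin n → Fin 4} :
    a ∈ stringsIn S ↔ ∀ i ∉ S, a i = 0 := by
  simp only [stringsIn, Fintype.mem_piFinset]
  refine forall_congr' fun i => ?_
  by_cases h : i ∈ S <;> simp [h]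

lemma card_stringsIn (S : Finset (Fin n)) : (stringsIn S).card = 4 ^ S.card := by
  rw [stringsIn, Fintype.card_piFinset]
  simp [apply_ite Finset.card, Finset.prod_ite_mem]

/-- Choose a qubit i outside S on which P_a is nontrivial, and flip bit i in both indices of the
trace sum. The entries of O survive only for equal i-th bits and are then unchanged, while the
diagonal of a nontrivial Pauli matrix changes sign. The trace equals its own negative. -/
lemma pauliCoeff_eq_zero {O : Op n} {S : Finset (Fin n)} {A : Matrix (S → Fin 2) (S → Fin 2) ℂ}
    (hO : ∀ x y, O x y = A (fun i => x i) (fun i => y i) * if ∀ i ∉ S, x i = y i then 1 else 0)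
    {a : Fin n → Fin 4} (ha : a ∉ stringsIn S) : pauliCoeff O a = 0 := by
  rw [mem_stringsIn] at ha
  push Not at ha
  obtain ⟨i, hi, hai⟩ := ha
  suffices h : (O * pauliString a).trace = 0 by rw [pauliCoeff, h]; simp
  let flip : Bits n → Bits n := fun x => Function.update x i (1 - x i)
  have hflip : Function.Involutive flip := by
    intro x
    simp [flip]
  have hsum : (O * pauliString a).trace = ∑ x, ∑ y, O (flip x) (flip y) *
      pauliString a (flip y) (flip x) := by
    rw [trace_mul_eq_sum, ← hflip.bijective.sum_comp]
    exact Finset.sum_congr rfl fun x _ =>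
      (hflip.bijective.sum_comp fun y => O (flip x) y * pauliString a y (flip x)).symm
  have hterm : ∀ x y, O (flip x) (flip y) * pauliString a (flip y) (flip x)
      = -(O x y * pauliString a y x) := by
    intro x y
    by_cases hxy : x i = y i
    · have e1 : O (flip x) (flip y) = O x y := by
        rw [hO, hO]
        have hS : ∀ x : Bits n, (fun j : S => flip x j) = fun j : S => x j := by
          intro x
          funext j
          exact Function.update_of_ne (fun h => hi (by rw [← h]; exact j.2)) _ _
        rw [hS, hS]
        congr 2
        refine propext (forall_congr' fun j => forall_congr' fun hj => ?_)
        by_cases hji : j = i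
        · subst hji
          simp [flip, hxy]
        · simp [flip, Function.update_of_ne hji]
      have e2 : pauliString a (flip y) (flip x) = -pauliString a y x := by
        simp only [pauliString, tensorOp_apply]
        rw [← Finset.mul_prod_erase _ _ (Finset.mem_univ i),
          ← Finset.mul_prod_erase _ _ (Finset.mem_univ i), ← neg_mul]
        congr 1
        · simp only [flip, Function.update_self, hxy]
          generalize y i = c
          revert hai
          generalize a i = e
          intro he
          fin_cases e <;> fin_cases c <;> simp [pauli] at he ⊢
        · refine Finset.prod_congr rfl fun j hj => ?_
          simp only [flip, Function.update_of_ne (Finset.ne_of_mem_erase hj)]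
      rw [e1, e2, mul_neg]
    · have e1 : O x y = 0 := by
        rw [hO, if_neg fun h => hxy (h i hi), mul_zero]
      have e2 : O (flip x) (flip y) = 0 := by
        rw [hO, if_neg, mul_zero]
        intro h
        have := h i hi
        simp [flip] at this
        exact hxy this
      rw [e1, e2]
      simp
  simp only [hterm, Finset.sum_neg_distrib, ← trace_mul_eq_sum] at hsum
  linear_combination (1 / 2 : ℂ) * hsum

/-! ### The estimators in terms of Pauli strings -/

/-- The bit that records whether a Pauli matrix is nontrivial. -/
def pauliBit (a : Fin 4) : Fin 2 := if a = 0 then 0 else 1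

/-- The support pattern of a Pauli string. -/
def pattern (a : Fin n → Fin 4) : Bits n := fun i => pauliBit (a i)

lemma noiseEst_eq (z : Bits n) (r : Round n) :
    noiseEst z r = roundVal (fun i => if z i = 0 then 0 else 3) r := by
  have h : pauliZ z = tensorOp fun i => pauli (if z i = 0 then 0 else 3) := by
    rw [pauliZ]
    congr 1
    funext i
    split_ifs <;> rfl
  rw [noiseEst, trace_basisState_mul, h, localUnitary_conj_tensorOp, tensorOp_apply, roundVal]
  simp only [← ofReal_diagVal, ← Complex.ofReal_prod, Complex.ofReal_re]

lemma identityProj_pauli (a : Fin 4) : identityProj (pauli a) = if a = 0 then pauli 0 else 0 := by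
  by_cases ha : a = 0
  · subst ha
    simp [identityProj, pauli_zero]
  · simp [identityProj, trace_pauli ha, ha]

lemma proj_shadowState (z : Fin 2) (g : Cl2) (b : Fin 2) :
    (if z = 0 then identityProj else LinearMap.id - identityProj) (shadowState g b)
      = ∑ a, ((2 : ℂ)⁻¹ * if pauliBit a = z then (diagVal g a b : ℂ) else 0) • pauli a := by
  have h1 : identityProj (shadowState g b) = (2 : ℂ)⁻¹ • (diagVal g 0 b : ℂ) • pauli 0 := by
    rw [shadowState_expansion]
    simp [identityProj_pauli]
  fin_cases z
  · simp [h1, pauliBit, smul_smul, -Complex.coe_smul]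
  · simp only [Fin.mk_one, one_ne_zero, if_false, LinearMap.sub_apply, LinearMap.id_apply, h1]
    rw [shadowState_expansion]
    simp [Fin.sum_univ_four, pauliBit, smul_smul, -Complex.coe_smul]
    abel

/-- The measured state is a product, and the sector projector for z keeps precisely its Pauli
strings with pattern z. Each string is thus rescaled by the inverse of one number. -/
lemma inverseChannel_shadow (f : Bits n → ℝ) (r : Round n) :
    inverseChannel f (star (localUnitary r.U) * basisState r.b * localUnitary r.U)
      = ∑ a, (((2 ^ n)⁻¹ * ((f (pattern a))⁻¹ * roundVal a r) : ℝ) : ℂ) • pauliString a := by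
  have h1 : star (localUnitary r.U) * basisState r.b * localUnitary r.U
      = tensorOp fun i => shadowState (r.U i) (r.b i) := by
    rw [localUnitary, star_tensorOp, ← tensorOp_basisState, tensorOp_mul, tensorOp_mul]
    rfl
  have h2 : ∀ z, sectorProj z (tensorOp fun i => shadowState (r.U i) (r.b i))
      = ∑ a, (if pattern a = z then (((2 ^ n)⁻¹ * roundVal a r : ℝ) : ℂ) else 0) •
          pauliString a := by
    intro z
    rw [sectorProj, tensorMap_tensorOp]
    simp only [proj_shadowState]
    rw [tensorOp_sum_smul_pauli]
    refine Finset.sum_congr rfl fun a _ => ?_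
    congr 1
    rw [Finset.prod_mul_distrib, Finset.prod_ite_zero]
    simp only [Finset.mem_univ, true_imp_iff, pattern, funext_iff, mul_ite, mul_zero, roundVal]
    simp
  rw [h1, inverseChannel]
  simp only [LinearMap.sum_apply, LinearMap.smul_apply, h2, Finset.smul_sum]
  rw [Finset.sum_comm]
  refine Finset.sum_congr rfl fun a _ => ?_
  simp only [smul_smul, ← Finset.sum_smul]
  congr 1
  simp
  ring

lemma singleEstimate_eq (f : Bits n → ℝ) {O : Op n} (hO : star O = O) (r : Round n) :
    singleEstimate f O r = ∑ a, (f (pattern a))⁻¹ * pauliCoeff O a * roundVal a r := by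
  rw [singleEstimate, inverseChannel_shadow, hO]
  simp only [Matrix.mul_sum, mul_smul_comm, Matrix.trace_sum, Matrix.trace_smul, smul_eq_mul,
    Complex.re_sum, Complex.re_ofReal_mul, pauliCoeff]
  exact Finset.sum_congr rfl fun a _ => by ring

end

/-! ### Pauli fidelities -/

section

variable {n : ℕ}

/-- The support of a bit string. -/
def bitSupp (z : Bits n) : Finset (Fin n) := Finset.univ.filter fun i => z i ≠ 0

/-- The Pauli fidelity `f_z` of the noisy measurement channel. -/
def fidelity (Λ : Fin n → QubitOp →ₗ[ℂ] QubitOp) (z : Bits n) : ℝ :=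
  ∏ i, if z i = 0 then 1 else zContraction (Λ i) * 3⁻¹

/-- The Pauli fidelity `3^{-|z|}` in the absence of noise. -/
def idealFidelity (z : Bits n) : ℝ := ∏ i, if z i = 0 then 1 else 3⁻¹

lemma pauliBit_eq_zero {a : Fin 4} : pauliBit a = 0 ↔ a = 0 := by
  by_cases h : a = 0 <;> simp [pauliBit, h]

lemma prod_pauliFidelity (Λ : Fin n → QubitOp →ₗ[ℂ] QubitOp) (a : Fin n → Fin 4) :
    ∏ i, pauliFidelity (Λ i) (a i) = fidelity Λ (pattern a) := by
  simp only [fidelity, pattern, pauliBit_eq_zero, pauliFidelity]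

lemma prod_axisProb (a : Fin n → Fin 4) : ∏ i, axisProb (a i) = idealFidelity (pattern a) := by
  simp only [idealFidelity, pattern, pauliBit_eq_zero, axisProb]

lemma pattern_ite (z : Bits n) : pattern (fun i => if z i = 0 then 0 else 3) = z := by
  funext i
  by_cases h : z i = 0
  · simp [pattern, pauliBit, h]
  · have : z i = 1 := by
      revert h
      generalize z i = c
      revert c
      decide
    simp [pattern, pauliBit, this]

lemma prod_ite_bit (z : Bits n) (c : ℝ) :
    (∏ i, if z i = 0 then 1 else c) = c ^ (bitSupp z).card := by
  rw [bitSupp, ← Finset.prod_const, Finset.prod_filter]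
  exact Finset.prod_congr rfl fun i _ => by by_cases h : z i = 0 <;> simp [h]

lemma idealFidelity_eq (z : Bits n) : idealFidelity z = 3⁻¹ ^ (bitSupp z).card :=
  prod_ite_bit z 3⁻¹

lemma idealFidelity_pos (z : Bits n) : 0 < idealFidelity z := by
  rw [idealFidelity_eq]
  positivity

lemma bitSupp_pattern_subset {S : Finset (Fin n)} {a : Fin n → Fin 4} (ha : a ∈ stringsIn S) :
    bitSupp (pattern a) ⊆ S := by
  intro i hi
  by_contra h
  have h1 : pattern a i ≠ 0 := by simpa [bitSupp] using hi
  exact h1 (pauliBit_eq_zero.2 (mem_stringsIn.1 ha i h))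

lemma one_le_pow_mul_idealFidelity {k : ℕ} {z : Bits n} (hz : (bitSupp z).card ≤ k) :
    1 ≤ 3 ^ k * idealFidelity z := by
  rw [idealFidelity_eq, inv_pow, ← div_eq_mul_inv, one_le_div (by positivity)]
  exact pow_le_pow_right₀ (by norm_num) hz

lemma mul_pow_le_fidelity {Λ : Fin n → QubitOp →ₗ[ℂ] QubitOp} {t : ℝ} (ht0 : 0 < t) (ht1 : t ≤ 1)
    (ht : ∀ i, t ≤ zContraction (Λ i)) {k : ℕ} {z : Bits n} (hz : (bitSupp z).card ≤ k) :
    idealFidelity z * t ^ k ≤ fidelity Λ z := by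
  calc idealFidelity z * t ^ k ≤ idealFidelity z * t ^ (bitSupp z).card :=
        mul_le_mul_of_nonneg_left (pow_le_pow_of_le_one ht0.le ht1 hz) (idealFidelity_pos z).le
    _ = ∏ i, if z i = 0 then 1 else t * 3⁻¹ := by
        rw [idealFidelity_eq, prod_ite_bit, mul_pow, mul_comm]
    _ ≤ fidelity Λ z := by
        refine Finset.prod_le_prod (fun i _ => by split_ifs <;> positivity) fun i _ => ?_
        split_ifs
        · exact le_rfl
        · exact mul_le_mul_of_nonneg_right (ht i) (by norm_num)

/-- A support of size at most k is listed by a k-tuple of positions, with `none` as padding. -/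
lemma card_bitSupp_le (k : ℕ) :
    (Finset.univ.filter fun z : Bits n => (bitSupp z).card ≤ k).card ≤ (n + 1) ^ k := by
  let F : (Fin k → Option (Fin n)) → Bits n := fun c i => if ∃ j, c j = some i then 1 else 0
  have h : Set.SurjOn F (Finset.univ : Finset (Fin k → Option (Fin n)))
      (Finset.univ.filter fun z : Bits n => (bitSupp z).card ≤ k) := by
    intro z hz
    have hz : (bitSupp z).card ≤ k := by simpa using hz
    refine ⟨fun j => if hj : (j : ℕ) < (bitSupp z).card then
      some ((bitSupp z).equivFin.symm ⟨j, hj⟩ : Fin n) else none, by simp, ?_⟩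
    funext i
    have hiff : (∃ j : Fin k, (if hj : (j : ℕ) < (bitSupp z).card then
        some ((bitSupp z).equivFin.symm ⟨j, hj⟩ : Fin n) else none) = some i) ↔ z i ≠ 0 := by
      constructor
      · rintro ⟨j, hj⟩
        split_ifs at hj with h1
        have h2 := ((bitSupp z).equivFin.symm ⟨j, h1⟩).2
        rw [Option.some.inj hj] at h2
        simpa [bitSupp] using h2
      · intro hi
        have hi' : i ∈ bitSupp z := by simpa [bitSupp] using hi
        let j := (bitSupp z).equivFin ⟨i, hi'⟩
        refine ⟨⟨j, j.2.trans_le hz⟩, ?_⟩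
        rw [dif_pos j.2]
        simp [j]
    simp only [F, hiff]
    generalize z i = c
    revert c
    decide
  refine (Finset.card_le_card_of_surjOn F h).trans ?_
  simp

end

/-! ### Calibration -/

section

variable {n : ℕ} {Λ : Fin n → QubitOp →ₗ[ℂ] QubitOp}

lemma isState_basisState (b : Bits n) : IsState (basisState b) := by
  refine ⟨basisState_posSemidef b, ?_⟩
  have := trace_basisState_mul b (1 : Op n)
  simpa using this

lemma isProbabilityMeasure_roundsLaw (hΛ : ∀ i, IsChannel (Λ i)) {ρ : Op n} (hρ : IsState ρ)
    (N K : ℕ) : IsProbabilityMeasure (roundsLaw (tensorMap Λ) ρ N K) := by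
  have := isProbabilityMeasure_roundLaw hΛ hρ
  rw [roundsLaw]
  infer_instance

lemma integral_noiseEst (hΛ : ∀ i, IsChannel (Λ i)) (z : Bits n) :
    ∫ r, noiseEst z r ∂(roundLaw (tensorMap Λ) (basisState 0)) = fidelity Λ z := by
  rw [integral_roundLaw hΛ (isState_basisState 0)]
  simp only [noiseEst_eq]
  rw [sum_roundProb_mul_roundVal hΛ, prod_pauliFidelity, pattern_ite, Matrix.trace_mul_comm,
    trace_basisState_mul, pauliString, tensorOp_apply]
  have : ∀ i, pauli (if z i = 0 then 0 else 3) 0 0 = 1 := by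
    intro i
    split_ifs <;> simp [pauli]
  simp [this]

lemma integral_noiseEst_sq (hΛ : ∀ i, IsChannel (Λ i)) (z : Bits n) :
    ∫ r, noiseEst z r ^ 2 ∂(roundLaw (tensorMap Λ) (basisState 0)) = idealFidelity z := by
  rw [integral_roundLaw hΛ (isState_basisState 0)]
  simp only [noiseEst_eq]
  rw [sum_roundProb_mul_roundVal_sq hΛ (isState_basisState 0), prod_axisProb, pattern_ite]

/-- The threshold used for z is γ t^k 3^{-|z|}, at most γ f_z, and the second moment is 3^{-|z|}.
Their Chebyshev ratio is worst at |z| = k, whence the factor 3^k. -/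
lemma calibration_tail (hΛ : ∀ i, IsChannel (Λ i)) {t : ℝ} (ht0 : 0 < t) (ht1 : t ≤ 1)
    (ht : ∀ i, t ≤ zContraction (Λ i)) {k N K : ℕ} (hN : 0 < N) (hK : 0 < K) {γ s : ℝ}
    (hγ : 0 < γ) (hs : 0 ≤ s) (h : 3 ^ k ≤ s ^ 2 * (N * (γ * t ^ k) ^ 2)) :
    (roundsLaw (tensorMap Λ) (basisState 0) N K).real
      {cal | ¬ ∀ z, (bitSupp z).card ≤ k → |fHat cal z - fidelity Λ z| ≤ γ * fidelity Λ z}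
      ≤ (n + 1) ^ k * (2 * s) ^ K := by
  have := isProbabilityMeasure_roundLaw hΛ (isState_basisState (0 : Bits n))
  have := isProbabilityMeasure_roundsLaw hΛ (isState_basisState (0 : Bits n)) N K
  set P := roundsLaw (tensorMap Λ) (basisState 0) N K
  let B : Bits n → Set (Fin K × Fin N → Round n) := fun z =>
    {cal | γ * t ^ k * idealFidelity z < |fHat cal z - fidelity Λ z|}
  have hB : ∀ z, (bitSupp z).card ≤ k → P.real (B z) ≤ (2 * s) ^ K := by
    intro z hz
    have hw := idealFidelity_pos z
    have h1 := medianOfMeans_tail (roundLaw (tensorMap Λ) (basisState 0)) (noiseEst z) hN hK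
      (η := γ * t ^ k * idealFidelity z) (V := idealFidelity z) (by positivity) hs
      (integral_noiseEst_sq hΛ z).le (by
        calc idealFidelity z ≤ idealFidelity z * (3 ^ k * idealFidelity z) :=
              le_mul_of_one_le_right hw.le (one_le_pow_mul_idealFidelity hz)
          _ = 3 ^ k * idealFidelity z ^ 2 := by ring
          _ ≤ s ^ 2 * (N * (γ * t ^ k) ^ 2) * idealFidelity z ^ 2 :=
              mul_le_mul_of_nonneg_right h (sq_nonneg _)
          _ = _ := by ring)
    rw [integral_noiseEst hΛ] at h1
    exact h1
  let Z := Finset.univ.filter fun z : Bits n => (bitSupp z).card ≤ k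
  have hsub : {cal : Fin K × Fin N → Round n |
      ¬ ∀ z, (bitSupp z).card ≤ k → |fHat cal z - fidelity Λ z| ≤ γ * fidelity Λ z}
      ⊆ ⋃ z ∈ Z, B z := by
    intro cal hcal
    have hcal' : ¬ ∀ z, (bitSupp z).card ≤ k →
      |fHat cal z - fidelity Λ z| ≤ γ * fidelity Λ z := hcal
    push Not at hcal'
    obtain ⟨z, hz, hlt⟩ := hcal'
    refine Set.mem_biUnion (x := z) (by simpa [Z] using hz) ?_
    refine lt_of_le_of_lt ?_ hlt
    rw [mul_assoc, mul_comm (t ^ k)]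
    exact mul_le_mul_of_nonneg_left (mul_pow_le_fidelity ht0 ht1 ht hz) hγ.le
  calc _ ≤ P.real (⋃ z ∈ Z, B z) := measureReal_mono hsub (measure_ne_top _ _)
    _ ≤ ∑ z ∈ Z, P.real (B z) := measureReal_biUnion_finset_le _ _
    _ ≤ ∑ z ∈ Z, (2 * s) ^ K := Finset.sum_le_sum fun z hz => hB z (by simpa [Z] using hz)
    _ = Z.card * (2 * s) ^ K := by simp
    _ ≤ (n + 1) ^ k * (2 * s) ^ K := by
        refine mul_le_mul_of_nonneg_right ?_ (by positivity)
        exact_mod_cast card_bitSupp_le k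

/-- The value of γ solves γ/(1-γ) = ε/c. As γ < 1, the hypothesis also forces g > 0, so the inverse
is a genuine one. -/
lemma abs_ratio_sub_one_le {f g γ ε c : ℝ} (hf : 0 < f) (hε : 0 < ε) (hc : 0 < c)
    (hγ : γ = ε / (ε + c)) (h : |g - f| ≤ γ * f) : |f * g⁻¹ - 1| ≤ ε / c := by
  have h1 := abs_le.1 h
  have hγ1 : 1 - γ = c / (ε + c) := by rw [hγ]; field_simp; ring
  have hg' : c / (ε + c) * f ≤ g := by rw [← hγ1]; linarith
  have hg : 0 < g := lt_of_lt_of_le (by positivity) hg'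
  have e : f * g⁻¹ - 1 = (f - g) / g := by field_simp
  rw [e, abs_div, abs_of_pos hg, div_le_div_iff₀ hg hc, abs_sub_comm]
  calc |g - f| * c ≤ γ * f * c := mul_le_mul_of_nonneg_right h hc.le
    _ = ε * (c / (ε + c) * f) := by rw [hγ]; ring
    _ ≤ ε * g := mul_le_mul_of_nonneg_left hg' hε.le

/-! ### Estimation -/

/-- The bias of the estimator under an accurate calibration. -/
lemma abs_integral_singleEstimate_sub_le (hΛ : ∀ i, IsChannel (Λ i)) {ρ O : Op n}
    (hρ : IsState ρ) {k : ℕ} {f : Bits n → ℝ} {ε : ℝ} (hε : 0 < ε)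
    (hf : ∀ z, (bitSupp z).card ≤ k → |fidelity Λ z * (f z)⁻¹ - 1| ≤ ε / 2 ^ k)
    (hO : star O = O) (hloc : IsLocal k O) (hn : ‖Matrix.toEuclideanCLM (𝕜 := ℂ) O‖ ≤ 1) :
    |∫ r, singleEstimate f O r ∂(roundLaw (tensorMap Λ) ρ) - (O * ρ).trace.re| ≤ ε := by
  obtain ⟨S, hS, A, hA⟩ := hloc
  have e1 : ∫ r, singleEstimate f O r ∂(roundLaw (tensorMap Λ) ρ)
      = ∑ a, (f (pattern a))⁻¹ * pauliCoeff O a *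
          (fidelity Λ (pattern a) * (pauliString a * ρ).trace.re) := by
    rw [integral_roundLaw hΛ hρ]
    simp only [singleEstimate_eq f hO, Finset.mul_sum]
    rw [Finset.sum_comm]
    refine Finset.sum_congr rfl fun a _ => ?_
    rw [← prod_pauliFidelity, ← sum_roundProb_mul_roundVal hΛ, Finset.mul_sum]
    exact Finset.sum_congr rfl fun r _ => by ring
  rw [e1, ← sum_pauliCoeff_mul hO hρ.1.isHermitian, ← Finset.sum_sub_distrib]
  have hzero : ∀ a, a ∉ stringsIn S → pauliCoeff O a = 0 := fun a ha => pauliCoeff_eq_zero hA ha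
  rw [← Finset.sum_subset (Finset.subset_univ (stringsIn S)) fun a _ ha => by simp [hzero a ha]]
  have hterm : ∀ a ∈ stringsIn S, |(f (pattern a))⁻¹ * pauliCoeff O a *
      (fidelity Λ (pattern a) * (pauliString a * ρ).trace.re)
        - pauliCoeff O a * (pauliString a * ρ).trace.re| ≤ ε / 2 ^ k * |pauliCoeff O a| := by
    intro a ha
    have e : (f (pattern a))⁻¹ * pauliCoeff O a *
      (fidelity Λ (pattern a) * (pauliString a * ρ).trace.re)
        - pauliCoeff O a * (pauliString a * ρ).trace.re
        = (fidelity Λ (pattern a) * (f (pattern a))⁻¹ - 1) * pauliCoeff O a *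
          (pauliString a * ρ).trace.re := by ring
    rw [e, abs_mul, abs_mul]
    have hb := hf (pattern a) ((Finset.card_le_card (bitSupp_pattern_subset ha)).trans hS.le)
    calc _ ≤ |fidelity Λ (pattern a) * (f (pattern a))⁻¹ - 1| * |pauliCoeff O a| * 1 :=
          mul_le_mul_of_nonneg_left (abs_re_trace_pauliString_mul_le hρ a) (by positivity)
      _ ≤ _ := by
          rw [mul_one]
          exact mul_le_mul_of_nonneg_right hb (abs_nonneg _)
  -- Cauchy-Schwarz over the 4^k strings in S, with the Parseval bound on the squares.
  have hl1 : ∑ a ∈ stringsIn S, |pauliCoeff O a| ≤ 2 ^ k := by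
    refine abs_le_of_sq_le_sq' ?_ (by positivity) |>.2
    calc (∑ a ∈ stringsIn S, |pauliCoeff O a|) ^ 2
        ≤ (stringsIn S).card * ∑ a ∈ stringsIn S, |pauliCoeff O a| ^ 2 :=
          sq_sum_le_card_mul_sum_sq
      _ ≤ 4 ^ k * 1 := by
          rw [card_stringsIn, hS]
          push_cast
          refine mul_le_mul_of_nonneg_left ?_ (by positivity)
          simp only [sq_abs]
          exact (Finset.sum_le_sum_of_subset_of_nonneg (Finset.subset_univ _)
            fun _ _ _ => sq_nonneg _).trans (sum_pauliCoeff_sq_le hO hn)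
      _ = (2 ^ k) ^ 2 := by rw [← pow_mul, mul_comm k 2, pow_mul]; norm_num
  calc _ ≤ ∑ a ∈ stringsIn S, ε / 2 ^ k * |pauliCoeff O a| :=
        (Finset.abs_sum_le_sum_abs _ _).trans (Finset.sum_le_sum hterm)
    _ = ε / 2 ^ k * ∑ a ∈ stringsIn S, |pauliCoeff O a| := by rw [Finset.mul_sum]
    _ ≤ ε / 2 ^ k * 2 ^ k := mul_le_mul_of_nonneg_left hl1 (by positivity)
    _ = ε := by field_simp

/-- The identity contributes 1, and the single visible nontrivial Pauli matrix contributes 3. -/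
lemma sum_inv_axisProb_mul_diagVal_sq (g : Cl2) (b : Fin 2) :
    ∑ a, (axisProb a)⁻¹ * diagVal g a b ^ 2 = 4 := by
  have h := sum_diagVal_sq g b
  rw [Fin.sum_univ_four] at h ⊢
  simp [axisProb, diagVal_zero] at h ⊢
  linarith

/-- In every round, the compatible Pauli strings supported in `S` have total weight `4^|S|`. -/
lemma sum_inv_idealFidelity_mul_roundVal_sq (S : Finset (Fin n)) (r : Round n) :
    ∑ a ∈ stringsIn S, (idealFidelity (pattern a))⁻¹ * roundVal a r ^ 2 = 4 ^ S.card := by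
  simp only [← prod_axisProb, roundVal, ← Finset.prod_inv_distrib, ← Finset.prod_pow,
    ← Finset.prod_mul_distrib]
  rw [stringsIn, ← Finset.prod_univ_sum (f := fun i a =>
    (axisProb a)⁻¹ * diagVal (r.U i) a (r.b i) ^ 2)]
  have : ∀ i, (∑ a ∈ (if i ∈ S then Finset.univ else {0}), (axisProb a)⁻¹ *
      diagVal (r.U i) a (r.b i) ^ 2) = if i ∈ S then 4 else 1 := by
    intro i
    split_ifs
    · exact sum_inv_axisProb_mul_diagVal_sq _ _
    · simp [axisProb, diagVal_zero]
  simp [this]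

/-- The second moment of the estimator under an accurate calibration. -/
lemma integral_singleEstimate_sq_le (hΛ : ∀ i, IsChannel (Λ i)) {ρ O : Op n}
    (hρ : IsState ρ) {k : ℕ} {f : Bits n → ℝ} {C : ℝ}
    (hf : ∀ z, (bitSupp z).card ≤ k → |(f z)⁻¹| ≤ C * (idealFidelity z)⁻¹)
    (hO : star O = O) (hloc : IsLocal k O) (hn : ‖Matrix.toEuclideanCLM (𝕜 := ℂ) O‖ ≤ 1) :
    ∫ r, singleEstimate f O r ^ 2 ∂(roundLaw (tensorMap Λ) ρ) ≤ C ^ 2 * 4 ^ k := by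
  obtain ⟨S, hS, A, hA⟩ := hloc
  have hzero : ∀ a, a ∉ stringsIn S → pauliCoeff O a = 0 := fun a ha => pauliCoeff_eq_zero hA ha
  have hpt : ∀ r, singleEstimate f O r ^ 2 ≤ C ^ 2 * 4 ^ k *
      ∑ a, (idealFidelity (pattern a))⁻¹ * pauliCoeff O a ^ 2 * roundVal a r ^ 2 := by
    intro r
    rw [singleEstimate_eq f hO,
      ← Finset.sum_subset (Finset.subset_univ (stringsIn S)) fun a _ ha => by simp [hzero a ha]]
    have hle : |∑ a ∈ stringsIn S, (f (pattern a))⁻¹ * pauliCoeff O a * roundVal a r|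
        ≤ C * ∑ a ∈ stringsIn S,
          (idealFidelity (pattern a))⁻¹ * |pauliCoeff O a| * roundVal a r ^ 2 := by
      refine (Finset.abs_sum_le_sum_abs _ _).trans ?_
      rw [Finset.mul_sum]
      refine Finset.sum_le_sum fun a ha => ?_
      rw [abs_mul, abs_mul, abs_roundVal, mul_assoc, mul_assoc, ← mul_assoc C]
      exact mul_le_mul_of_nonneg_right
        (hf _ ((Finset.card_le_card (bitSupp_pattern_subset ha)).trans hS.le)) (by positivity)
    -- Splitting with the weights 3^{|a|} makes the first factor the constant 4^k in every round. In
    -- the second factor, averaging the squared round values gives 3^{-|a|}, which cancels the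
    -- weights and leaves ∑ c_a² ≤ 1.
    have hcs := Finset.sum_sq_le_sum_mul_sum_of_sq_le_mul (stringsIn S)
      (r := fun a => (idealFidelity (pattern a))⁻¹ * |pauliCoeff O a| * roundVal a r ^ 2)
      (f := fun a => (idealFidelity (pattern a))⁻¹ * roundVal a r ^ 2)
      (g := fun a => (idealFidelity (pattern a))⁻¹ * pauliCoeff O a ^ 2 * roundVal a r ^ 2)
      (fun a _ => mul_nonneg (inv_nonneg.2 (idealFidelity_pos _).le) (sq_nonneg _))
      (fun a _ => mul_nonneg (mul_nonneg (inv_nonneg.2 (idealFidelity_pos _).le) (sq_nonneg _))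
        (sq_nonneg _))
      (fun a _ => le_of_eq (by rw [mul_pow, mul_pow, sq_abs]; ring))
    rw [sum_inv_idealFidelity_mul_roundVal_sq, hS] at hcs
    calc _ ≤ (C * ∑ a ∈ stringsIn S,
          (idealFidelity (pattern a))⁻¹ * |pauliCoeff O a| * roundVal a r ^ 2) ^ 2 := by
          rw [← sq_abs]
          exact pow_le_pow_left₀ (abs_nonneg _) hle 2
      _ ≤ C ^ 2 * (4 ^ k * ∑ a ∈ stringsIn S,
          (idealFidelity (pattern a))⁻¹ * pauliCoeff O a ^ 2 * roundVal a r ^ 2) := by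
          rw [mul_pow]
          exact mul_le_mul_of_nonneg_left hcs (sq_nonneg _)
      _ ≤ _ := by
          rw [mul_assoc]
          refine mul_le_mul_of_nonneg_left (mul_le_mul_of_nonneg_left ?_ (by positivity))
            (sq_nonneg _)
          refine Finset.sum_le_sum_of_subset_of_nonneg (Finset.subset_univ _) fun a _ _ => ?_
          have := idealFidelity_pos (pattern a)
          positivity
  rw [integral_roundLaw hΛ hρ]
  calc _ ≤ ∑ r, roundProb (tensorMap Λ) ρ r * (C ^ 2 * 4 ^ k *
      ∑ a, (idealFidelity (pattern a))⁻¹ * pauliCoeff O a ^ 2 * roundVal a r ^ 2) :=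
        Finset.sum_le_sum fun r _ =>
          mul_le_mul_of_nonneg_left (hpt r) (roundProb_nonneg hΛ hρ r)
    _ = C ^ 2 * 4 ^ k * ∑ a, (idealFidelity (pattern a))⁻¹ * pauliCoeff O a ^ 2 *
        ∑ r, roundProb (tensorMap Λ) ρ r * roundVal a r ^ 2 := by
        simp only [Finset.mul_sum]
        rw [Finset.sum_comm]
        exact Finset.sum_congr rfl fun a _ => Finset.sum_congr rfl fun r _ => by ring
    _ = C ^ 2 * 4 ^ k * ∑ a, pauliCoeff O a ^ 2 := by
        congr 1
        refine Finset.sum_congr rfl fun a _ => ?_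
        have := (idealFidelity_pos (pattern a)).ne'
        rw [sum_roundProb_mul_roundVal_sq hΛ hρ, prod_axisProb]
        field_simp
    _ ≤ C ^ 2 * 4 ^ k * 1 :=
        mul_le_mul_of_nonneg_left (sum_pauliCoeff_sq_le hO hn) (by positivity)
    _ = _ := mul_one _

/-- The error splits into a bias of at most ε₁ and a statistical deviation exceeding ε₂ with small
probability. An accurate calibration also bounds the inverse fidelities by (1+ε₁) t^{-k} 3^{|z|},
which feeds the second moment bound. Patterns of weight above k are uncontrolled but meet only zero
coefficients. -/
lemma estimation_tail (hΛ : ∀ i, IsChannel (Λ i)) {t : ℝ} (ht0 : 0 < t) (ht1 : t ≤ 1)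
    (ht : ∀ i, t ≤ zContraction (Λ i)) {ρ O : Op n} (hρ : IsState ρ) {k N K : ℕ}
    (hN : 0 < N) (hK : 0 < K) {f : Bits n → ℝ} {ε₁ ε₂ s : ℝ} (hε₁ : 0 < ε₁) (hε₂ : 0 < ε₂)
    (hf : ∀ z, (bitSupp z).card ≤ k → |fidelity Λ z * (f z)⁻¹ - 1| ≤ ε₁ / 2 ^ k)
    (hO : star O = O) (hloc : IsLocal k O) (hn : ‖Matrix.toEuclideanCLM (𝕜 := ℂ) O‖ ≤ 1)
    (hs : 0 ≤ s) (h : ((1 + ε₁) * (t ^ k)⁻¹) ^ 2 * 4 ^ k ≤ s ^ 2 * (N * ε₂ ^ 2)) :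
    (roundsLaw (tensorMap Λ) ρ N K).real
      {est | ε₁ + ε₂ < |medianOfMeans (fun p => singleEstimate f O (est p)) - (O * ρ).trace.re|}
      ≤ (2 * s) ^ K := by
  have := isProbabilityMeasure_roundLaw hΛ hρ
  have := isProbabilityMeasure_roundsLaw hΛ hρ N K
  have hC : ∀ z, (bitSupp z).card ≤ k →
      |(f z)⁻¹| ≤ (1 + ε₁) * (t ^ k)⁻¹ * (idealFidelity z)⁻¹ := by
    intro z hz
    have hw := idealFidelity_pos z
    have hfid := mul_pow_le_fidelity ht0 ht1 ht hz
    have hpos : 0 < fidelity Λ z := lt_of_lt_of_le (by positivity) hfid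
    have h1 : fidelity Λ z * |(f z)⁻¹| ≤ 1 + ε₁ := by
      have h2 := hf z hz
      have h3 : ε₁ / 2 ^ k ≤ ε₁ := div_le_self hε₁.le (one_le_pow₀ (by norm_num))
      have h4 : |fidelity Λ z * (f z)⁻¹| ≤ |fidelity Λ z * (f z)⁻¹ - 1| + |1| := by
        simpa using abs_add_le (fidelity Λ z * (f z)⁻¹ - 1) 1
      rw [abs_mul, abs_of_pos hpos, abs_one] at h4
      linarith
    rw [mul_assoc, ← mul_inv, ← div_eq_mul_inv, le_div_iff₀ (by positivity)]
    calc |(f z)⁻¹| * (t ^ k * idealFidelity z) = idealFidelity z * t ^ k * |(f z)⁻¹| := by ring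
      _ ≤ fidelity Λ z * |(f z)⁻¹| := mul_le_mul_of_nonneg_right hfid (abs_nonneg _)
      _ ≤ 1 + ε₁ := h1
  have hbias := abs_integral_singleEstimate_sub_le hΛ hρ hε₁ hf hO hloc hn
  have htail := medianOfMeans_tail (roundLaw (tensorMap Λ) ρ) (singleEstimate f O) hN hK hε₂ hs
    (integral_singleEstimate_sq_le hΛ hρ hC hO hloc hn) h
  refine le_trans (measureReal_mono ?_ (measure_ne_top _ _)) htail
  intro est hest
  have hest' : ε₁ + ε₂ < |medianOfMeans (fun p => singleEstimate f O (est p))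
    - (O * ρ).trace.re| := hest
  change ε₂ < |_|
  have := abs_sub_le (medianOfMeans (fun p => singleEstimate f O (est p)))
    (∫ r, singleEstimate f O r ∂(roundLaw (tensorMap Λ) ρ)) ((O * ρ).trace.re)
  linarith

end

/-! ### The protocol -/

/-- A two-stage union bound: the first stage fails with probability at most `δ₁`, and after any
success of the first stage the second one fails with probability at most `δ₂`. -/
lemma prod_real_ge {α β : Type} [MeasurableSpace α] [MeasurableSpace β] [Finite α] [Finite β]
    [DiscreteMeasurableSpace α] [DiscreteMeasurableSpace β] (μ : Measure α) (ν : Measure β)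
    [IsProbabilityMeasure μ] [IsProbabilityMeasure ν] {G : Set α} {W : Set (α × β)} {δ₁ δ₂ : ℝ}
    (hG : μ.real Gᶜ ≤ δ₁) (hδ₂ : 0 ≤ δ₂)
    (hW : ∀ x ∈ G, ν.real {y | (x, y) ∉ W} ≤ δ₂) :
    1 - δ₁ - δ₂ ≤ (μ.prod ν).real W := by
  let D : Set (α × β) := {p | p.1 ∈ G ∧ p ∉ W}
  have hD : (μ.prod ν).real D ≤ δ₂ := by
    refine ENNReal.toReal_le_of_le_ofReal hδ₂ ?_
    rw [Measure.prod_apply MeasurableSet.of_discrete]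
    calc ∫⁻ x, ν (Prod.mk x ⁻¹' D) ∂μ ≤ ∫⁻ _, ENNReal.ofReal δ₂ ∂μ := by
          refine lintegral_mono fun x => ?_
          by_cases hx : x ∈ G
          · have h1 : Prod.mk x ⁻¹' D = {y | (x, y) ∉ W} := by
              ext y
              simp [D, hx]
            rw [h1]
            exact (ENNReal.le_ofReal_iff_toReal_le (measure_ne_top _ _) hδ₂).2 (hW x hx)
          · have h1 : Prod.mk x ⁻¹' D = ∅ := by
              ext y
              simp [D, hx]
            simp [h1]
      _ = ENNReal.ofReal δ₂ := by simp
  have hG' : (μ.prod ν).real (Gᶜ ×ˢ Set.univ) ≤ δ₁ := by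
    rw [measureReal_prod_prod]
    simpa using hG
  have hsub : Wᶜ ⊆ (Gᶜ ×ˢ Set.univ) ∪ D := by
    intro p hp
    by_cases h : p.1 ∈ G
    · exact Or.inr ⟨h, hp⟩
    · exact Or.inl ⟨h, trivial⟩
  have h1 := (measureReal_mono (μ := μ.prod ν) hsub (measure_ne_top _ _)).trans
    (measureReal_union_le _ _)
  rw [probReal_compl_eq_one_sub MeasurableSet.of_discrete] at h1
  linarith

/-- For n ≥ 2 one has n + 1 ≤ n². For n = 1 the bound k ≤ n leaves k ∈ {0, 1}, where the factor 4
suffices. -/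
lemma succ_pow_le {n k : ℕ} (hn : 1 ≤ n) (hk : k ≤ n) :
    ((n : ℝ) + 1) ^ k ≤ 4 * ((n : ℝ) ^ k) ^ 2 := by
  rcases hn.eq_or_lt with rfl | h2
  · interval_cases k <;> norm_num
  · have h2' : (2 : ℝ) ≤ n := by exact_mod_cast h2
    have h3 : ((n : ℝ) + 1) ^ k ≤ (n ^ 2) ^ k :=
      pow_le_pow_left₀ (by positivity) (by nlinarith) k
    rw [← pow_mul, mul_comm 2 k, pow_mul] at h3
    have : 0 ≤ ((n : ℝ) ^ k) ^ 2 := by positivity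
    linarith

/-- The factor 2 in the exponent turns the exponential into δ²/(4 n^{2k}), whose denominator absorbs
the number (n+1)^k of patterns. -/
lemma succ_pow_mul_exp_le {n k : ℕ} (hn : 1 ≤ n) (hk : k ≤ n) {δ : ℝ} (hδ : 0 < δ) (hδ' : δ < 1) :
    ((n : ℝ) + 1) ^ k * Real.exp (-(2 * (k * Real.log n + Real.log (2 * δ⁻¹)))) ≤ δ := by
  have hn' : (0 : ℝ) < n := by exact_mod_cast hn
  have e : Real.exp (k * Real.log n + Real.log (2 * δ⁻¹)) = (n : ℝ) ^ k * (2 * δ⁻¹) := by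
    rw [Real.exp_add, Real.exp_nat_mul, Real.exp_log hn', Real.exp_log (by positivity)]
  have e2 : Real.exp (-(2 * (k * Real.log n + Real.log (2 * δ⁻¹))))
      = (((n : ℝ) ^ k * (2 * δ⁻¹)) ^ 2)⁻¹ := by
    rw [Real.exp_neg, two_mul, Real.exp_add, e, sq]
  have hp : (0 : ℝ) < (n : ℝ) ^ k := by positivity
  rw [e2, ← div_eq_mul_inv, div_le_iff₀ (by positivity)]
  have e3 : δ * ((n : ℝ) ^ k * (2 * δ⁻¹)) ^ 2 = 4 * ((n : ℝ) ^ k) ^ 2 * δ⁻¹ := by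
    field_simp
    ring
  rw [e3]
  refine (succ_pow_le hn hk).trans (le_mul_of_one_le_right (by positivity) ?_)
  exact (one_le_inv₀ hδ).2 hδ'.le

/-- The parameters s₁, s₂ isolate the choice of batches: s² bounds the failure of one batch, (2s)^K
that of the median. Both parts of the theorem reduce to finding suitable s. -/
lemma succeeds_of_batchTail {n k M : ℕ} (hn : 1 ≤ n) (hk : k ≤ n) (hM : 1 ≤ M)
    {ξ ε₁ ε₂ δ₁ δ₂ : ℝ} (hξ₀ : 0 ≤ ξ) (hξ : ξ < 1 / 2) (hε₁ : 0 < ε₁) (hε₂ : 0 < ε₂)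
    (hδ₁ : 0 < δ₁) (hδ₁' : δ₁ < 1) (hδ₂ : 0 < δ₂) {N₁ K₁ N₂ K₂ : ℕ}
    (hN₁ : 0 < N₁) (hK₁ : 0 < K₁) (hN₂ : 0 < N₂) (hK₂ : 0 < K₂) {s₁ s₂ : ℝ}
    (hs₁ : 0 ≤ s₁) (hs₂ : 0 ≤ s₂)
    (hA₁ : 34 * 3 ^ k * (1 + 2 ^ k / ε₁) ^ 2 * ((1 - 2 * ξ) ^ (2 * k))⁻¹ ≤ 34 * (s₁ ^ 2 * N₁))
    (hB₁ : (2 * s₁) ^ K₁ ≤ Real.exp (-(2 * (k * Real.log n + Real.log (2 * δ₁⁻¹)))))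
    (hA₂ : 34 / ε₂ ^ 2 * 4 ^ k * (1 + ε₁) ^ 2 * ((1 - 2 * ξ) ^ (2 * k))⁻¹ ≤ 34 * (s₂ ^ 2 * N₂))
    (hB₂ : (2 * s₂) ^ K₂ ≤ Real.exp (-Real.log (2 * M / δ₂))) :
    Succeeds n k M ξ (ε₁ + ε₂) (1 - δ₁ - δ₂) N₁ K₁ N₂ K₂ := by
  intro Λ hΛ hF ρ hρ O hO hloc hnorm
  have ht0 : 0 < 1 - 2 * ξ := by linarith
  have ht1 : 1 - 2 * ξ ≤ 1 := by linarith
  have ht : ∀ i, 1 - 2 * ξ ≤ zContraction (Λ i) := by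
    intro i
    have := hF i
    rw [zContraction]
    linarith
  generalize 1 - 2 * ξ = t at ht0 ht1 ht hA₁ hA₂
  have := isProbabilityMeasure_roundsLaw hΛ (isState_basisState (0 : Bits n)) N₁ K₁
  have := isProbabilityMeasure_roundsLaw hΛ hρ N₂ K₂
  have h2k : (0 : ℝ) < 2 ^ k := by positivity
  -- Here γ (1 + 2^k/ε₁) = 1, which is the origin of that factor in the calibration batch size.
  set γ := ε₁ / (ε₁ + 2 ^ k) with hγ
  have hγ0 : 0 < γ := by positivity
  have hcal := calibration_tail hΛ ht0 ht1 ht (k := k) hN₁ hK₁ hγ0 hs₁ (by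
    have e : 3 ^ k = 3 ^ k * (1 + 2 ^ k / ε₁) ^ 2 * (t ^ (2 * k))⁻¹ * (γ * t ^ k) ^ 2 := by
      rw [hγ, pow_mul']
      field_simp
    rw [e, ← mul_assoc]
    refine mul_le_mul_of_nonneg_right ?_ (sq_nonneg _)
    linarith)
  have hM0 : (0 : ℝ) < M := by exact_mod_cast hM
  have hest : ∀ f : Bits n → ℝ,
      (∀ z, (bitSupp z).card ≤ k → |f z - fidelity Λ z| ≤ γ * fidelity Λ z) → ∀ i,
      (roundsLaw (tensorMap Λ) ρ N₂ K₂).real {est | ε₁ + ε₂ <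
        |medianOfMeans (fun p => singleEstimate f (O i) (est p)) - (O i * ρ).trace.re|}
        ≤ (2 * s₂) ^ K₂ := by
    intro f hf i
    refine estimation_tail hΛ ht0 ht1 ht hρ hN₂ hK₂ hε₁ hε₂ (fun z hz => ?_) (hO i) (hloc i)
      (hnorm i) hs₂ ?_
    · have hpos : 0 < fidelity Λ z :=
        lt_of_lt_of_le (mul_pos (idealFidelity_pos z) (pow_pos ht0 k))
          (mul_pow_le_fidelity ht0 ht1 ht hz)
      exact abs_ratio_sub_one_le hpos hε₁ h2k hγ (hf z hz)
    · have e : ((1 + ε₁) * (t ^ k)⁻¹) ^ 2 * 4 ^ k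
          = 1 / ε₂ ^ 2 * 4 ^ k * (1 + ε₁) ^ 2 * (t ^ (2 * k))⁻¹ * ε₂ ^ 2 := by
        rw [pow_mul']
        field_simp
      rw [e, ← mul_assoc]
      refine mul_le_mul_of_nonneg_right ?_ (sq_nonneg _)
      have : 34 / ε₂ ^ 2 * 4 ^ k * (1 + ε₁) ^ 2 * (t ^ (2 * k))⁻¹
        = 34 * (1 / ε₂ ^ 2 * 4 ^ k * (1 + ε₁) ^ 2 * (t ^ (2 * k))⁻¹) := by ring
      linarith
  refine prod_real_ge _ _
    (G := {cal | ∀ z, (bitSupp z).card ≤ k → |fHat cal z - fidelity Λ z| ≤ γ * fidelity Λ z})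
    ?_ hδ₂.le ?_
  · refine hcal.trans ?_
    exact (mul_le_mul_of_nonneg_left hB₁ (by positivity)).trans
      (succ_pow_mul_exp_le hn hk hδ₁ hδ₁')
  · intro cal hcal
    have hsub : {est : Fin K₂ × Fin N₂ → Round n | (cal, est) ∉
        {ω : (Fin K₁ × Fin N₁ → Round n) × (Fin K₂ × Fin N₂ → Round n) |
          ∀ i, |estimate ω.1 ω.2 (O i) - ((O i * ρ).trace).re| ≤ ε₁ + ε₂}}
        ⊆ ⋃ i ∈ (Finset.univ : Finset (Fin M)), {est | ε₁ + ε₂ <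
          |medianOfMeans (fun p => singleEstimate (fHat cal) (O i) (est p))
            - (O i * ρ).trace.re|} := by
      intro est h
      have h' : ¬ ∀ i, |estimate cal est (O i) - ((O i * ρ).trace).re| ≤ ε₁ + ε₂ := h
      push Not at h'
      obtain ⟨i, hi⟩ := h'
      exact Set.mem_biUnion (Finset.mem_coe.2 (Finset.mem_univ i)) hi
    calc _ ≤ _ := measureReal_mono hsub (measure_ne_top _ _)
      _ ≤ _ := measureReal_biUnion_finset_le _ _
      -- Each of the M observables fails with probability at most δ₂/(2M).
      _ ≤ ∑ _i : Fin M, Real.exp (-Real.log (2 * M / δ₂)) :=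
          Finset.sum_le_sum fun i _ => (hest _ hcal i).trans hB₂
      _ = δ₂ / 2 := by
          rw [Real.exp_neg, Real.exp_log (by positivity)]
          simp
          field_simp
      _ ≤ δ₂ := by linarith

/-! ### Choice of the batches -/

lemma exp_two_le : Real.exp 2 ≤ 7.4 := by
  have h1 := Real.exp_one_lt_d9
  have h2 : Real.exp 2 = Real.exp 1 * Real.exp 1 := by rw [← Real.exp_add]; norm_num
  have h3 := Real.exp_pos 1
  rw [h2]
  nlinarith

/-- By convexity the exponential lies below its chord on [1, 2], with e ≤ 3 and e² ≤ 7.4. The -1 on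
the right is what later pays for rounding down the batch size. -/
lemma four_mul_exp_le {y : ℝ} (h1 : 1 ≤ y) (h2 : y ≤ 2) : 4 * Real.exp y ≤ 17 * y - 1 := by
  have hc := convexOn_exp.2 (Set.mem_univ (1 : ℝ)) (Set.mem_univ (2 : ℝ))
    (sub_nonneg.2 h2) (sub_nonneg.2 h1) (by ring)
  simp only [smul_eq_mul] at hc
  have e : (2 - y) * 1 + (y - 1) * 2 = y := by ring
  rw [e] at hc
  have h3 : (2 - y) * Real.exp 1 ≤ (2 - y) * 3 :=
    mul_le_mul_of_nonneg_left (Real.exp_one_lt_d9.le.trans (by norm_num)) (by linarith)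
  have h4 := mul_le_mul_of_nonneg_left exp_two_le (sub_nonneg.2 h1)
  linarith

/-- Taking s = 1/(2e) makes (2s)^K equal to e^{-K}, and 34 s² = 34/(4e²) ≥ 1. -/
lemma exists_batchTail_of_le {A B : ℝ} {N K : ℕ} (hA : A ≤ N) (hB : B ≤ K) :
    ∃ s : ℝ, 0 ≤ s ∧ A ≤ 34 * (s ^ 2 * N) ∧ (2 * s) ^ K ≤ Real.exp (-B) := by
  have hs : (Real.exp (-1) / 2) ^ 2 = Real.exp (-2) / 4 := by
    rw [div_pow, sq (Real.exp _), ← Real.exp_add]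
    norm_num
  refine ⟨Real.exp (-1) / 2, by positivity, ?_, ?_⟩
  · rw [hs]
    have h1 : (34 / 4 : ℝ) * Real.exp (-2) ≥ 1 := by
      rw [Real.exp_neg, ← div_eq_mul_inv, ge_iff_le, one_le_div (Real.exp_pos 2)]
      exact exp_two_le.trans (by norm_num)
    have h2 := mul_le_mul_of_nonneg_right h1 (Nat.cast_nonneg (α := ℝ) N)
    linarith
  · rw [mul_div_cancel₀ _ two_ne_zero, ← Real.exp_nat_mul]
    exact Real.exp_le_exp.2 (by linarith)

/-- Rounding: a budget of `R ≥ A B` samples can be split into batches. -/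
lemma exists_batches {A B : ℝ} (hA : 34 ≤ A) (hB : Real.log 2 ≤ B) {R : ℕ} (hR : A * B ≤ R) :
    ∃ N K : ℕ, 0 < N ∧ 0 < K ∧ N * K ≤ R ∧
      ∃ s : ℝ, 0 ≤ s ∧ A ≤ 34 * (s ^ 2 * N) ∧ (2 * s) ^ K ≤ Real.exp (-B) := by
  have hlog := Real.log_two_gt_d9
  have hB0 : 1 / 2 < B := by linarith
  set K := ⌈B⌉₊ with hKdef
  have hK : 0 < K := Nat.ceil_pos.2 (by linarith)
  have hK0 : (0 : ℝ) < K := Nat.cast_pos.2 hK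
  have hBK : B ≤ K := Nat.le_ceil B
  have hKB : (K : ℝ) < B + 1 := Nat.ceil_lt_add_one (by linarith)
  -- Rounding up at most doubles B: for K = 1 because log 2 > 1/2, for K ≥ 2 because K < B + 1 gives
  -- B > K/2. So y = 2B/K lies in [1, 2].
  have hhalf : (K : ℝ) ≤ 2 * B := by
    rcases Nat.eq_or_lt_of_le (Nat.succ_le_of_lt hK) with h1 | h1
    · rw [← h1]; push_cast; linarith
    · have : (2 : ℝ) ≤ K := by exact_mod_cast h1
      linarith
  set N := R / K with hNdef
  have hNR : (R : ℝ) < K * (N + 1) := by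
    have := Nat.lt_mul_div_succ R hK
    exact_mod_cast this
  have hx1 : 1 ≤ 2 * B / K := by rw [le_div_iff₀ hK0]; linarith
  have hx2 : 2 * B / K ≤ 2 := by rw [div_le_iff₀ hK0]; linarith
  have hexp := four_mul_exp_le hx1 hx2
  have hN1 : A * (2 * B / K) ≤ 2 * (N + 1) := by
    rw [mul_div_assoc', div_le_iff₀ hK0]
    linarith
  have hA0 : 0 < A := by linarith
  have hN : 0 < N := by
    have h3 : A * 1 ≤ A * (2 * B / K) := mul_le_mul_of_nonneg_left hx1 hA0.le
    have h4 : (0 : ℝ) < N := by linarith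
    exact_mod_cast h4
  have hN0 : (0 : ℝ) < N := Nat.cast_pos.2 hN
  -- This s makes (2s)^K exactly e^{-B}, so the excess of K over B is spent on a larger s, and hence
  -- on a smaller required N.
  refine ⟨N, K, hN, hK, Nat.div_mul_le_self R K, Real.exp (-(B / K)) / 2, by positivity, ?_, ?_⟩
  · have hs : (Real.exp (-(B / K)) / 2) ^ 2 = (Real.exp (2 * B / K))⁻¹ / 4 := by
      rw [div_pow, sq (Real.exp _), ← Real.exp_add, ← Real.exp_neg]
      ring_nf
    have hE := Real.exp_pos (2 * B / K)
    rw [hs]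
    -- With y = 2B/K the left side is at most A(17y - 1) ≤ 34(N + 1) - A, and A ≥ 34 absorbs the
    -- unit lost in the floor.
    have h5 : A * (4 * Real.exp (2 * B / K)) ≤ 34 * N :=
      (mul_le_mul_of_nonneg_left hexp hA0.le).trans (by linarith)
    have e : 34 * ((Real.exp (2 * B / K))⁻¹ / 4 * N) = 34 * N / (4 * Real.exp (2 * B / K)) := by
      field_simp
    rw [e, le_div_iff₀ (by positivity)]
    exact h5
  · rw [mul_div_cancel₀ _ two_ne_zero, ← Real.exp_nat_mul]
    refine le_of_eq (congrArg Real.exp ?_)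
    field_simp

end RShadow

end

theorem mainTheorem6 (n k M : ℕ) (hn : 1 ≤ n) (hk : k ≤ n) (hM : 1 ≤ M)
    (ξ ε₁ ε₂ δ₁ δ₂ : ℝ) (hξ₀ : 0 ≤ ξ) (hξ : ξ < 1 / 2)
    (hε₁ : 0 < ε₁) (hε₂ : 0 < ε₂)
    (hδ₁ : 0 < δ₁) (hδ₁' : δ₁ < 1) (hδ₂ : 0 < δ₂) (hδ₂' : δ₂ < 1) :
    (∀ N₁ K₁ N₂ K₂ : ℕ,
      34 * 3 ^ k * (1 + 2 ^ k / ε₁) ^ 2 * ((1 - 2 * ξ) ^ (2 * k))⁻¹ ≤ (N₁ : ℝ) →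
      2 * (k * Real.log n + Real.log (2 * δ₁⁻¹)) ≤ (K₁ : ℝ) →
      34 / ε₂ ^ 2 * 4 ^ k * (1 + ε₁) ^ 2 * ((1 - 2 * ξ) ^ (2 * k))⁻¹ ≤ (N₂ : ℝ) →
      Real.log (2 * M / δ₂) ≤ (K₂ : ℝ) →
      RShadow.Succeeds n k M ξ (ε₁ + ε₂) (1 - δ₁ - δ₂) N₁ K₁ N₂ K₂) ∧
    (ε₂ ≤ 1 → ∀ R₁ R₂ : ℕ,
      68 * 3 ^ k * (1 + 2 ^ k / ε₁) ^ 2 * (k * Real.log n + Real.log (2 * δ₁⁻¹)) *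
        ((1 - 2 * ξ) ^ (2 * k))⁻¹ ≤ (R₁ : ℝ) →
      34 / ε₂ ^ 2 * 4 ^ k * Real.log (2 * M / δ₂) * (1 + ε₁) ^ 2 *
        ((1 - 2 * ξ) ^ (2 * k))⁻¹ ≤ (R₂ : ℝ) →
      ∃ N₁ K₁ N₂ K₂ : ℕ, 0 < N₁ ∧ 0 < K₁ ∧ 0 < N₂ ∧ 0 < K₂ ∧
        N₁ * K₁ ≤ R₁ ∧ N₂ * K₂ ≤ R₂ ∧
        RShadow.Succeeds n k M ξ (ε₁ + ε₂) (1 - δ₁ - δ₂) N₁ K₁ N₂ K₂) := by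
  have ht0 : 0 < 1 - 2 * ξ := by linarith
  have hlog2 : 0 < Real.log 2 := Real.log_pos one_lt_two
  have hM' : (1 : ℝ) ≤ M := by exact_mod_cast hM
  have hL₁ : Real.log 2 ≤ 2 * (k * Real.log n + Real.log (2 * δ₁⁻¹)) := by
    have h1 : 0 ≤ k * Real.log n :=
      mul_nonneg (Nat.cast_nonneg k) (Real.log_nonneg (by exact_mod_cast hn))
    have h2 : Real.log 2 ≤ Real.log (2 * δ₁⁻¹) :=
      Real.log_le_log two_pos (le_mul_of_one_le_right two_pos.le ((one_le_inv₀ hδ₁).2 hδ₁'.le))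
    linarith
  have hL₂ : Real.log 2 ≤ Real.log (2 * M / δ₂) := by
    refine Real.log_le_log two_pos ?_
    rw [le_div_iff₀ hδ₂]
    nlinarith
  have hA₁ : 0 < 34 * 3 ^ k * (1 + 2 ^ k / ε₁) ^ 2 * ((1 - 2 * ξ) ^ (2 * k))⁻¹ := by positivity
  have hA₂ : 0 < 34 / ε₂ ^ 2 * 4 ^ k * (1 + ε₁) ^ 2 * ((1 - 2 * ξ) ^ (2 * k))⁻¹ := by positivity
  constructor
  · intro N₁ K₁ N₂ K₂ hN₁ hK₁ hN₂ hK₂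
    obtain ⟨s₁, hs₁, hA₁', hB₁⟩ := RShadow.exists_batchTail_of_le hN₁ hK₁
    obtain ⟨s₂, hs₂, hA₂', hB₂⟩ := RShadow.exists_batchTail_of_le hN₂ hK₂
    refine RShadow.succeeds_of_batchTail hn hk hM hξ₀ hξ hε₁ hε₂ hδ₁ hδ₁' hδ₂ ?_ ?_ ?_ ?_ hs₁ hs₂
      hA₁' hB₁ hA₂' hB₂
    · exact Nat.cast_pos.1 (hA₁.trans_le hN₁)
    · exact Nat.cast_pos.1 ((hlog2.trans_le hL₁).trans_le hK₁)
    · exact Nat.cast_pos.1 (hA₂.trans_le hN₂)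
    · exact Nat.cast_pos.1 ((hlog2.trans_le hL₂).trans_le hK₂)
  · intro hε₂' R₁ R₂ hR₁ hR₂
    have hinv : 1 ≤ ((1 - 2 * ξ) ^ (2 * k))⁻¹ :=
      (one_le_inv₀ (by positivity)).2 (pow_le_one₀ ht0.le (by linarith))
    have h34₁ : 34 ≤ 34 * 3 ^ k * (1 + 2 ^ k / ε₁) ^ 2 * ((1 - 2 * ξ) ^ (2 * k))⁻¹ := by
      have h1 : (1 : ℝ) ≤ 3 ^ k := one_le_pow₀ (by norm_num)
      have h2 : 1 ≤ (1 + 2 ^ k / ε₁) ^ 2 := one_le_pow₀ (le_add_of_nonneg_right (by positivity))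
      have h3 := one_le_mul_of_one_le_of_one_le (one_le_mul_of_one_le_of_one_le h1 h2) hinv
      linarith
    have h34₂ : 34 ≤ 34 / ε₂ ^ 2 * 4 ^ k * (1 + ε₁) ^ 2 * ((1 - 2 * ξ) ^ (2 * k))⁻¹ := by
      -- This is where ε₂ ≤ 1 enters: it keeps the batch constant at least 34, as the rounding
      -- argument requires.
      have h0 : 1 ≤ 1 / ε₂ ^ 2 := (one_le_div (by positivity)).2 (pow_le_one₀ hε₂.le hε₂')
      have h1 : (1 : ℝ) ≤ 4 ^ k := one_le_pow₀ (by norm_num)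
      have h2 : 1 ≤ (1 + ε₁) ^ 2 := one_le_pow₀ (by linarith)
      have h3 := one_le_mul_of_one_le_of_one_le (one_le_mul_of_one_le_of_one_le
        (one_le_mul_of_one_le_of_one_le h0 h1) h2) hinv
      have e : 34 / ε₂ ^ 2 * 4 ^ k * (1 + ε₁) ^ 2 * ((1 - 2 * ξ) ^ (2 * k))⁻¹
        = 34 * (1 / ε₂ ^ 2 * 4 ^ k * (1 + ε₁) ^ 2 * ((1 - 2 * ξ) ^ (2 * k))⁻¹) := by ring
      linarith
    obtain ⟨N₁, K₁, hN₁, hK₁, hNK₁, s₁, hs₁, hA₁', hB₁⟩ :=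
      RShadow.exists_batches h34₁ hL₁ (R := R₁) (le_of_eq_of_le (by ring) hR₁)
    obtain ⟨N₂, K₂, hN₂, hK₂, hNK₂, s₂, hs₂, hA₂', hB₂⟩ :=
      RShadow.exists_batches h34₂ hL₂ (R := R₂) (le_of_eq_of_le (by ring) hR₂)
    exact ⟨N₁, K₁, N₂, K₂, hN₁, hK₁, hN₂, hK₂, hNK₁, hNK₂,
      RShadow.succeeds_of_batchTail hn hk hM hξ₀ hξ hε₁ hε₂ hδ₁ hδ₁' hδ₂ hN₁ hK₁ hN₂ hK₂ hs₁ hs₂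
        hA₁' hB₁ hA₂' hB₂⟩
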